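/- (The local Stirling formula.) Let $k$ be a nonarchimedean local field (of any characteristic), let $\mathcal O$ be its maximal compact subring (ring of integers), and let $q$ be the cardinality of the residue field of $\mathcal O$. Let $\mathbf e:k\to U(1)$ be a nonconstant continuous homomorphism from the additive group of $k$ to the group of complex numbers of absolute value $1$, and fix $\kappa\in k^\times$ with $\kappa^{-1}\mathcal O=\{\xi\in k\mid \xi\mathcal O\subseteq\ker\mathbf e\}$. Let $\mu$ be the Haar measure on $k$ with $\mu(\mathcal O)\,\mu(\kappa^{-1}\mathcal O)=1$, and let $\mu^\times$ be the Haar measure on $k^\times$ with $\mu^\times(\mathcal O^\times)=1$. For $a\in k$ put $\|a\|=\mu(a\mathcal O)/\mu(\mathcal O)$, and for $a\neq 0$ put $\operatorname{ord}a=-\log\|a\|/\log q$. Write $\mathbf 1_S$ for the function equal to $1$ on $S$ and $0$ elsewhere. Let $\mathrm{Sch}(k)$ be the Schwartz space, i.e. the space of locally constant, compactly supported functions $k\to\mathbb C$, and for $\mu$-integrable $f:k\to\mathbb C$ let $\mathcal F[f](\xi)=\int f(x)\,\mathbf e(-x\xi)\,d\mu(x)$ be its Fourier transform. For $\Phi\in\mathrm{Sch}(k)$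 and $x\in k^\times$ put $$\mathcal M^{(1)}[\Phi]=\int_{k^\times}\bigl(\Phi(t)-\mathbf 1_{\mathcal O}(t)\Phi(0)\bigr)\,d\mu^\times(t),$$ $$\mathcal L^{+}[\Phi](x)=\int_{k^\times}\frac{H(t^{-1})\Phi(xt)-\frac12\mathbf 1_{\mathcal O^\times}(t)\Phi(x)}{\|t-1\|}\,\|t\|\,d\mu^\times(t),\qquad H=\mathbf 1_{\mathcal O}-\tfrac12\mathbf 1_{\mathcal O^\times}.$$ These integrals converge absolutely, and $\mathcal F$ maps $\mathrm{Sch}(k)$ into itself. There exists a unique $\mathbb C$-linear operator $\mathcal K:\mathrm{Sch}(k)\to\mathrm{Sch}(k)$ such that, for all $\Phi\in\mathrm{Sch}(k)$ and $x\in k$, $$\mathcal K[\Phi](x)=\begin{cases}-\Phi(x)\left(\frac12\operatorname{ord}\kappa+\operatorname{ord}x\right)+\mathcal L^{+}[\Phi](x)&\text{if }x\neq0,\\[1mm]-\frac12\Phi(0)\operatorname{ord}\kappa+\mathcal M^{(1)}[\Phi]&\text{if }x=0.\end{cases}$$ Moreover, $\mathcal K[\mathcal F[\Phi]]=-\mathcal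 F[\mathcal K[\Phi]]$ for all $\Phi\in\mathrm{Sch}(k)$. -/

import Mathlib

open MeasureTheory
open scoped ValuativeRel

noncomputable section

namespace LocalStirling

/-- The Schwartz space `Sch(X)`: locally constant, compactly supported `ℂ`-valued functions. -/
def Sch (X : Type*) [TopologicalSpace X] : Submodule ℂ (X → ℂ) where
  carrier := {Φ | IsLocallyConstant Φ ∧ HasCompactSupport Φ}
  zero_mem' := ⟨IsLocallyConstant.const 0, HasCompactSupport.zero⟩
  add_mem' := fun hf hg => ⟨hf.1.add hg.1, hf.2.add hg.2⟩
  smul_mem' := fun c _ hf => ⟨hf.1.comp (fun z => c • z), hf.2.smul_left (f := fun _ => c)⟩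

section

variable (k : Type*) [Field k] [ValuativeRel k]

/-- The ring of integers `𝒪`, as a subset of `k`. -/
def integers : Set k := (𝒪[k] : Set k)

/-- The unit group `𝒪ˣ`, as a subset of `kˣ`. -/
def integerUnits : Set kˣ := {u | (u : k) ∈ integers k ∧ ((u⁻¹ : kˣ) : k) ∈ integers k}

/-- The residue cardinality `q`. -/
def residueCard : ℕ := Nat.card 𝓀[k]

end

variable {k : Type*} [Field k] [ValuativeRel k] [MeasurableSpace k]

/-- The dilate `a𝒪`. -/
def dilate (a : k) : Set k := (fun y : k => a * y) '' integers k

/-- `‖a‖ = μ(a𝒪) / μ(𝒪)`. -/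
def modulus (μ : Measure k) (a : k) : ℝ :=
  (μ (dilate a)).toReal / (μ (integers k)).toReal

/-- `ord a = - log ‖a‖ / log q`, meaningful for `a ≠ 0`. -/
def ord (μ : Measure k) (a : k) : ℝ :=
  -(Real.log (modulus μ a) / Real.log (residueCard k))

/-- The integrand `Φ(t) - 1_{a𝒪}(t) Φ(0)` of `M^{(a)}[Φ]`. -/
def mIntegrand (a : kˣ) (Φ : k → ℂ) (t : kˣ) : ℂ :=
  Φ t - (dilate (a : k)).indicator 1 (t : k) * Φ 0

/-- The linear functional `M^{(a)}`; `ν` is the Haar measure on `kˣ`. -/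
def M (ν : Measure kˣ) (a : kˣ) (Φ : k → ℂ) : ℂ := ∫ t, mIntegrand a Φ t ∂ν

/-- The function `H = 1_𝒪 - ½ 1_{𝒪ˣ}` on `kˣ`. -/
def H (t : kˣ) : ℂ :=
  (integers k).indicator 1 (t : k) - (1 / 2) * (integerUnits k).indicator 1 t

/-- The integrand of `L⁺[Φ](x)`. -/
def lPlusIntegrand (μ : Measure k) (Φ : k → ℂ) (x : k) (t : kˣ) : ℂ :=
  (H (t⁻¹) * Φ (x * t) - (1 / 2) * (integerUnits k).indicator 1 t * Φ x) /
    (modulus μ ((t : k) - 1) : ℂ) * (modulus μ (t : k) : ℂ)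

/-- The operator `L⁺`, evaluated at a nonzero point `x`. -/
def LPlus (μ : Measure k) (ν : Measure kˣ) (Φ : k → ℂ) (x : k) : ℂ :=
  ∫ t, lPlusIntegrand μ Φ x t ∂ν

/-- The formula that defines the operator `K`, separately for `x ≠ 0` and for `x = 0`. -/
def IsStirlingOperator [TopologicalSpace k] (κ : kˣ) (μ : Measure k) (ν : Measure kˣ)
    (K : Sch k →ₗ[ℂ] Sch k) : Prop :=
  ∀ Φ : Sch k,
    (∀ x : k, x ≠ 0 →
      (K Φ : k → ℂ) x =
        -(Φ : k → ℂ) x * ((1 / 2) * (ord μ (κ : k) : ℂ) + (ord μ x : ℂ)) + LPlus μ ν Φ x) ∧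
    (K Φ : k → ℂ) 0 = -(1 / 2) * (Φ : k → ℂ) 0 * (ord μ (κ : k) : ℂ) + M ν 1 Φ

end LocalStirling

end

/-!
Write `q` for the residue cardinality, `o` for `ord κ`, and `B_j` for the fractional ideal
`{x | j ≤ ord x}`. Let `P_j` be multiplication by the indicator of `B_j`, and let `Q_j` replace a
function by its mean over the translates of `B_j`. The Fourier transform `F` exchanges the two
families: `F P_j = Q_{j'} F` and `F Q_j = P_{j'} F` with `j' = -j - o` (`fourierOp_P`,
`fourierOp_Q`), because `B_{j'}` is the annihilator of `B_j`. Moreover `P_j Q_j = Q_j P_j`.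

The operator `K` is written in terms of these. With
`T_j = (q - 1)⁻¹ (P_j Q_j - P_{j+1} Q_{j+1} + q P_{j+1} Q_j - q Q_j P_{j+1})
  + Q_j - P_{j+1} - 1 + 2 [j < 0]` (`elemOp`)
one has `2 K + o = ∑ j, T_j`, a sum in which almost all terms vanish on a given Schwartz function
(`stirlingOp`). In particular `K` preserves the Schwartz space.

Away from the origin this identity comes from two decompositions of the integrand of `L⁺[Φ](x)`
(`sum_lLayer`): the region `‖t‖ > 1` is split into spheres, and on the unit group
`‖t - 1‖⁻¹` is the sum of `1` and of `q ^ i - q ^ (i - 1)` for `1 ≤ i ≤ ord (t - 1)`, so that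
the integral becomes a sum of the differences `Q_j Φ (x) - Φ (x)`. The sphere means are
`(q E_j - E_{j+1}) / (q - 1)` with `E_j = Q_j Φ (0)` (`integral_sphere`), since multiplicative Haar
measure is proportional to `dx / ‖x‖` (`mulMeasure_eq_smul`). The value at the origin is similar
(`sum_mLayer`).

The commutation rules give `F T_j = -T_i F + 2 ([j < 0] - [j < -o]) F` with `i = -1 - o - j`
(`fourierOp_elemOp`). Summing over `j`, the scalars add up to `2 o`, which turns
`F (2 K + o) = -(2 K + o) F + 2 o F` into `F K = -K F` (`stirlingOp_fourierOp`).
-/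

noncomputable section

set_option linter.unusedSectionVars false

namespace LocalStirling

open scoped WithZero Pointwise
open IsNonarchimedeanLocalField ValuativeRel

/-! ### The normalized valuation and the balls it defines -/

section Valuation

variable (k : Type*) [Field k] [ValuativeRel k] [TopologicalSpace k]
  [IsNonarchimedeanLocalField k]

/-- The valuation of `k`, with value group identified with `ℤᵐ⁰`. -/
def intVal : Valuation k ℤᵐ⁰ :=
  (valuation k).map (valueGroupWithZeroIsoInt k).toMonoidWithZeroHom
    (valueGroupWithZeroIsoInt k).strictMono.monotone

lemma intVal_apply (x : k) : intVal k x = valueGroupWithZeroIsoInt k (valuation k x) := rfl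

/-- The fractional ideal `{x | j ≤ ord x}`, as an additive subgroup. -/
def ball (j : ℤ) : AddSubgroup k where
  carrier := {x | intVal k x ≤ WithZero.exp (-j)}
  zero_mem' := by simp
  add_mem' := fun ha hb => ((intVal k).map_add _ _).trans (max_le ha hb)
  neg_mem' := fun ha => by simpa [Valuation.map_neg] using ha

variable {k}

/-- The normalized additive valuation of `x`, as an integer; `ordZ 0 = 0` is a junk value. -/
def ordZ (x : k) : ℤ := -WithZero.log (intVal k x)

lemma mem_ball_iff_intVal {x : k} {j : ℤ} : x ∈ ball k j ↔ intVal k x ≤ WithZero.exp (-j) :=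
  Iff.rfl

lemma intVal_ne_zero {x : k} (hx : x ≠ 0) : intVal k x ≠ 0 :=
  (Valuation.ne_zero_iff _).2 hx

lemma mem_ball_iff {x : k} (hx : x ≠ 0) {j : ℤ} : x ∈ ball k j ↔ j ≤ ordZ x := by
  rw [mem_ball_iff_intVal, ← WithZero.log_le_iff_le_exp (intVal_ne_zero hx), ordZ]
  omega

lemma ordZ_mul {x y : k} (hx : x ≠ 0) (hy : y ≠ 0) : ordZ (x * y) = ordZ x + ordZ y := by
  rw [ordZ, map_mul, WithZero.log_mul (intVal_ne_zero hx) (intVal_ne_zero hy), ordZ, ordZ]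
  ring

lemma ordZ_one : ordZ (1 : k) = 0 := by simp [ordZ]

lemma ordZ_inv (x : k) : ordZ x⁻¹ = -ordZ x := by
  rw [ordZ, map_inv₀, WithZero.log_inv, ordZ]

lemma exists_ordZ_eq (j : ℤ) : ∃ x : k, x ≠ 0 ∧ ordZ x = j := by
  obtain ⟨x, hx⟩ := valuation_surjective ((valueGroupWithZeroIsoInt k).symm (WithZero.exp (-j)))
  have h : intVal k x = WithZero.exp (-j) := by
    rw [intVal_apply, hx]
    exact (valueGroupWithZeroIsoInt k).toEquiv.apply_symm_apply _
  refine ⟨x, ?_, by rw [ordZ, h, WithZero.log_exp, neg_neg]⟩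
  rintro rfl
  exact WithZero.exp_ne_zero (h.symm.trans (map_zero _))

lemma ball_anti {i j : ℤ} (h : i ≤ j) : ball k j ≤ ball k i := fun _ hx =>
  le_trans (mem_ball_iff_intVal.1 hx) (WithZero.exp_le_exp.2 (by omega))

lemma mul_mem_ball_iff {a x : k} (ha : a ≠ 0) {j : ℤ} :
    a * x ∈ ball k j ↔ x ∈ ball k (j - ordZ a) := by
  rcases eq_or_ne x 0 with rfl | hx
  · simp
  · rw [mem_ball_iff (mul_ne_zero ha hx), mem_ball_iff hx, ordZ_mul ha hx]
    omega

lemma integers_eq_ball : integers k = ball k 0 := by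
  ext x
  rw [SetLike.mem_coe, mem_ball_iff_intVal, neg_zero, WithZero.exp_zero, intVal_apply,
    ← map_one (valueGroupWithZeroIsoInt k), (valueGroupWithZeroIsoInt k).strictMono.le_iff_le]
  rfl

lemma dilate_eq_ball {a : k} (ha : a ≠ 0) : dilate a = ball k (ordZ a) := by
  ext x
  rw [dilate, integers_eq_ball]
  constructor
  · rintro ⟨y, hy, rfl⟩
    simpa [mul_mem_ball_iff ha] using hy
  · intro hx
    refine ⟨a⁻¹ * x, ?_, mul_inv_cancel_left₀ ha x⟩
    rw [SetLike.mem_coe, mul_mem_ball_iff (inv_ne_zero ha), ordZ_inv]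
    simpa using hx

lemma mem_integerUnits_iff {u : kˣ} : u ∈ integerUnits k ↔ ordZ (u : k) = 0 := by
  rw [integerUnits, Set.mem_ofPred_eq, integers_eq_ball, SetLike.mem_coe, SetLike.mem_coe,
    mem_ball_iff u.ne_zero, mem_ball_iff (Units.ne_zero _), Units.val_inv_eq_inv_val, ordZ_inv]
  omega

lemma mem_ball_ordZ {x : k} (hx : x ≠ 0) : x ∈ ball k (ordZ x) := (mem_ball_iff hx).2 le_rfl

lemma exists_mem_ball (x : k) : ∃ j, x ∈ ball k j := by
  rcases eq_or_ne x 0 with rfl | hx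
  · exact ⟨0, zero_mem _⟩
  · exact ⟨_, mem_ball_ordZ hx⟩

lemma isOpen_ball (j : ℤ) : IsOpen (ball k j : Set k) := by
  obtain ⟨a, ha, rfl⟩ := exists_ordZ_eq (k := k) j
  rw [← dilate_eq_ball ha, dilate]
  exact (Homeomorph.mulLeft₀ a ha).isOpenMap _ (Valuation.isOpen_integer (v := valuation k))

lemma isCompact_ball (j : ℤ) : IsCompact (ball k j : Set k) := by
  obtain ⟨a, ha, rfl⟩ := exists_ordZ_eq (k := k) j
  rw [← dilate_eq_ball ha, dilate]
  exact (isCompact_closedBall k 1).image (continuous_const_mul a)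

lemma isClosed_ball (j : ℤ) : IsClosed (ball k j : Set k) :=
  (ball k j).isClosed_of_isOpen (isOpen_ball j)

lemma isClopen_ball (j : ℤ) : IsClopen (ball k j : Set k) := ⟨isClosed_ball j, isOpen_ball j⟩

lemma exists_ball_subset {s : Set k} (hs : s ∈ nhds (0 : k)) : ∃ j, (ball k j : Set k) ⊆ s := by
  obtain ⟨γ, hγ, h⟩ := (IsValuativeTopology.hasBasis_nhds_zero' k).mem_iff.mp hs
  obtain ⟨r, rfl⟩ := valuation_surjective γ
  have hr : r ≠ 0 := by rintro rfl; simp at hγ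
  refine ⟨ordZ r + 1, fun x hx => h ?_⟩
  have hx' : intVal k x < intVal k r := by
    refine lt_of_le_of_lt (mem_ball_iff_intVal.1 hx) ?_
    rw [← WithZero.lt_log_iff_exp_lt (intVal_ne_zero hr), ordZ]
    omega
  exact (valueGroupWithZeroIsoInt k).strictMono.lt_iff_lt.1 hx'

/-- Two points at distance smaller than their size have the same size. -/
lemma ordZ_eq_of_sub_mem {x y : k} (hx : x ≠ 0) (h : y - x ∈ ball k (ordZ x + 1)) :
    y ≠ 0 ∧ ordZ y = ordZ x := by
  have hy : y ≠ 0 := by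
    rintro rfl
    rw [zero_sub, neg_mem_iff, mem_ball_iff hx] at h
    omega
  refine ⟨hy, le_antisymm ?_ ?_⟩
  · by_contra hlt
    have h1 : y ∈ ball k (ordZ x + 1) := (mem_ball_iff hy).2 (by omega)
    have h2 := sub_mem h1 h
    rw [sub_sub_cancel, mem_ball_iff hx] at h2
    omega
  · rw [← mem_ball_iff hy]
    simpa using add_mem (ball_anti (by omega) h) (mem_ball_ordZ hx)

/-- The index of `ϖ 𝒪` in `𝒪` is the residue cardinality. -/
lemma relIndex_ball_one : (ball k 1).relIndex (ball k 0) = residueCard k := by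
  have h0 : ball k 0 = 𝒪[k].toAddSubgroup := SetLike.coe_injective integers_eq_ball.symm
  have h1 : (ball k 1).addSubgroupOf 𝒪[k].toAddSubgroup
      = (Submodule.toAddSubgroup 𝓂[k] : AddSubgroup 𝒪[k]) := by
    ext x
    have hx : valuation k (x : k) ≤ 1 := x.2
    have h2 : (x : k) ∈ ball k 1 ↔ intVal k x < intVal k 1 := by
      rw [mem_ball_iff_intVal, map_one, ← WithZero.lt_mul_exp_iff_le WithZero.exp_ne_zero,
        ← WithZero.exp_add]
      simp
    rw [intVal_apply, intVal_apply, (valueGroupWithZeroIsoInt k).strictMono.lt_iff_lt,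
      map_one] at h2
    refine Iff.trans h2 (Iff.trans ?_ (IsLocalRing.mem_maximalIdeal (R := 𝒪[k]) x).symm)
    rw [mem_nonunits_iff,
      Valuation.Integers.isUnit_iff_valuation_eq_one (Valuation.integer.integers _)]
    exact ⟨fun h => h.ne, fun h => lt_of_le_of_ne hx h⟩
  rw [h0, AddSubgroup.relIndex, h1]
  rfl

lemma one_lt_residueCard : 1 < residueCard k := Finite.one_lt_card

instance t2Space : T2Space k :=
  IsTopologicalAddGroup.t2Space_of_zero_sep fun x hx =>
    ⟨ball k (ordZ x + 1), (isOpen_ball _).mem_nhds (zero_mem _), by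
      rw [SetLike.mem_coe, mem_ball_iff hx]
      omega⟩

instance secondCountable : SecondCountableTopology k := by
  let := IsTopologicalAddGroup.rightUniformSpace k
  have := isUniformAddGroup_of_addCommGroup (G := k)
  let : (Valued.v (R := k)).RankOne :=
  { hom' := IsRankLeOne.nonempty.some.emb (R := k).comp MonoidWithZeroHom.ValueGroup₀.embedding
    strictMono' := IsRankLeOne.nonempty.some.strictMono.comp
        MonoidWithZeroHom.ValueGroup₀.embedding_strictMono }
  open scoped Valued in
  have : ProperSpace k := .of_nontriviallyNormedField_of_weaklyLocallyCompactSpace k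
  infer_instance

end Valuation

/-! ### Additive Haar measure of balls -/

section Haar

variable {k : Type*} [Field k] [ValuativeRel k] [TopologicalSpace k]
  [IsNonarchimedeanLocalField k] [MeasurableSpace k] [BorelSpace k]
  (μ : Measure k) [μ.IsAddHaarMeasure]

lemma measurableSet_ball (j : ℤ) : MeasurableSet (ball k j : Set k) := (isOpen_ball j).measurableSet

lemma measure_ball_ne_top (j : ℤ) : μ (ball k j) ≠ ⊤ := (isCompact_ball j).measure_ne_top

lemma measure_ball_ne_zero (j : ℤ) : μ (ball k j) ≠ 0 :=
  ((isOpen_ball j).measure_pos μ ⟨0, zero_mem _⟩).ne'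

/-- Cosets of `H` in `K` are translates of `H`, so `μ K = [K : H] μ H`. -/
lemma measure_eq_relIndex_mul {H K : AddSubgroup k} (hHK : H ≤ K) (hH : MeasurableSet (H : Set k))
    (hfin : H.relIndex K ≠ 0) : μ K = H.relIndex K * μ H := by
  have : Finite (K ⧸ H.addSubgroupOf K) := Nat.finite_of_card_ne_zero hfin
  have : Fintype (K ⧸ H.addSubgroupOf K) := Fintype.ofFinite _
  have hU : (K : Set k) = ⋃ c : K ⧸ H.addSubgroupOf K,
      (fun x => -(c.out : k) + x) ⁻¹' (H : Set k) := by
    ext x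
    simp only [Set.mem_iUnion, Set.mem_preimage, SetLike.mem_coe]
    constructor
    · intro hx
      refine ⟨QuotientAddGroup.mk ⟨x, hx⟩, ?_⟩
      have := QuotientAddGroup.eq.1 (QuotientAddGroup.out_eq'
        (QuotientAddGroup.mk ⟨x, hx⟩ : K ⧸ H.addSubgroupOf K))
      simpa [AddSubgroup.mem_addSubgroupOf] using this
    · rintro ⟨c, hc⟩
      simpa using add_mem (c.out).2 (hHK hc)
  have hd : Pairwise (Function.onFun Disjoint fun c : K ⧸ H.addSubgroupOf K =>
      (fun x => -(c.out : k) + x) ⁻¹' (H : Set k)) := by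
    intro c d hcd
    refine Set.disjoint_left.2 fun x hx hx' => hcd ?_
    have h : -(c.out : k) + x - (-(d.out : k) + x) ∈ H := sub_mem (H := H) hx hx'
    rw [add_sub_add_right_eq_sub, neg_sub_neg] at h
    rw [← QuotientAddGroup.out_eq' c, ← QuotientAddGroup.out_eq' d, QuotientAddGroup.eq,
      AddSubgroup.mem_addSubgroupOf]
    simpa [sub_eq_add_neg, add_comm] using h
  rw [hU, measure_iUnion hd fun c => hH.preimage (measurable_const_add _)]
  simp_rw [measure_preimage_add]
  rw [tsum_fintype, Finset.sum_const, nsmul_eq_mul, Finset.card_univ, ← Nat.card_eq_fintype_card]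
  rfl

lemma distribHaarChar_mul_measure_ball (u : kˣ) (j : ℤ) :
    (distribHaarChar k u : ENNReal) * μ (ball k j) = μ (ball k (ordZ (u : k) + j)) := by
  obtain ⟨a, ha, rfl⟩ := exists_ordZ_eq (k := k) j
  rw [distribHaarChar_mul, ← ordZ_mul u.ne_zero ha, ← dilate_eq_ball (mul_ne_zero u.ne_zero ha),
    ← dilate_eq_ball ha, dilate, dilate]
  congr 1
  ext x
  simp [Set.mem_smul_set, Units.smul_def, mul_assoc]

/-- The Haar measure of a ball shrinks by the factor `q` from one radius to the next. -/
lemma measure_ball_succ (j : ℤ) : μ (ball k j) = residueCard k * μ (ball k (j + 1)) := by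
  have h := measure_eq_relIndex_mul μ (ball_anti (k := k) zero_le_one) (measurableSet_ball 1)
    (by rw [relIndex_ball_one]; exact (zero_lt_one.trans one_lt_residueCard).ne')
  obtain ⟨a, ha, rfl⟩ := exists_ordZ_eq (k := k) j
  have h0 := distribHaarChar_mul_measure_ball μ (Units.mk0 a ha) 0
  have h1 := distribHaarChar_mul_measure_ball μ (Units.mk0 a ha) 1
  rw [Units.val_mk0] at h0 h1
  rw [add_zero] at h0
  rw [← h0, ← h1, h, relIndex_ball_one]
  ring

lemma residueCard_cast_ne_zero {R : Type*} [AddMonoidWithOne R] [CharZero R] :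
    (residueCard k : R) ≠ 0 :=
  Nat.cast_ne_zero.2 (zero_lt_one.trans (one_lt_residueCard (k := k))).ne'

lemma measureReal_ball (j : ℤ) :
    μ.real (ball k j) = (residueCard k : ℝ) ^ (-j) * μ.real (ball k 0) := by
  have hq : (residueCard k : ℝ) ≠ 0 := residueCard_cast_ne_zero
  have step (j : ℤ) : μ.real (ball k j) = residueCard k * μ.real (ball k (j + 1)) := by
    simp [measureReal_def, measure_ball_succ μ j, ENNReal.toReal_mul]
  induction j using Int.induction_on with
  | zero => simp
  | succ n ih =>
    rw [step] at ih
    rw [neg_add, ← sub_eq_add_neg, zpow_sub_one₀ hq, mul_right_comm, ← ih]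
    field_simp
  | pred n ih =>
    rw [step, sub_add_cancel, ih, neg_sub, sub_eq_add_neg, add_comm, zpow_add_one₀ hq]
    ring

lemma measureReal_ball_pos (j : ℤ) : 0 < μ.real (ball k j) :=
  ENNReal.toReal_pos (measure_ball_ne_zero μ j) (measure_ball_ne_top μ j)

lemma modulus_eq {a : k} (ha : a ≠ 0) : modulus μ a = (residueCard k : ℝ) ^ (-ordZ a) := by
  have h : modulus μ a = μ.real (ball k (ordZ a)) / μ.real (ball k 0) := by
    rw [modulus, dilate_eq_ball ha, integers_eq_ball]
    rfl
  rw [h, measureReal_ball, mul_div_cancel_right₀ _ (measureReal_ball_pos μ 0).ne']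

lemma ord_eq {a : k} (ha : a ≠ 0) : ord μ a = ordZ a := by
  have hq : Real.log (residueCard k) ≠ 0 :=
    (Real.log_pos (by exact_mod_cast one_lt_residueCard (k := k))).ne'
  rw [ord, modulus_eq μ ha, Real.log_zpow, mul_div_cancel_right₀ _ hq]
  simp

lemma distribHaarChar_eq (u : kˣ) :
    (distribHaarChar k u : ℝ) = (residueCard k : ℝ) ^ (-ordZ (u : k)) := by
  have h := congrArg ENNReal.toReal
    (distribHaarChar_mul_measure_ball (Measure.addHaar (G := k)) u 0)
  rw [ENNReal.toReal_mul, add_zero] at h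
  change _ * Measure.real _ _ = Measure.real _ _ at h
  rw [measureReal_ball _ (ordZ _)] at h
  exact mul_right_cancel₀ (measureReal_ball_pos _ 0).ne' h

end Haar

/-! ### Comparison of multiplicative and additive Haar measure -/

section Units

variable {k : Type*} [Field k] [ValuativeRel k] [TopologicalSpace k]
  [IsNonarchimedeanLocalField k]

lemma isLocallyConstant_ordZ_units : IsLocallyConstant fun u : kˣ => ordZ (u : k) := by
  refine (IsLocallyConstant.iff_eventually_eq _).2 fun u => ?_
  have h : ∀ᶠ y : k in nhds (u : k), y - (u : k) ∈ ball k (ordZ (u : k) + 1) := by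
    have hc : Continuous fun y : k => y - (u : k) := continuous_id.sub continuous_const
    refine hc.continuousAt.eventually_mem ((isOpen_ball _).mem_nhds ?_)
    rw [sub_self]
    exact zero_mem _
  exact (Units.continuous_val.tendsto u).eventually
    (h.mono fun y hy => (ordZ_eq_of_sub_mem u.ne_zero hy).2)

lemma mem_ball_diff_iff {x : k} {j : ℤ} :
    x ∈ (ball k j : Set k) \ ball k (j + 1) ↔ x ≠ 0 ∧ ordZ x = j := by
  rcases eq_or_ne x 0 with rfl | hx
  · simp
  · rw [Set.mem_sdiff, SetLike.mem_coe, SetLike.mem_coe, mem_ball_iff hx, mem_ball_iff hx]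
    simp only [ne_eq, hx, not_false_eq_true, true_and]
    omega

lemma isCompact_units_ordZ_eq (j : ℤ) : IsCompact {u : kˣ | ordZ (u : k) = j} := by
  rw [Units.isEmbedding_val₀.isCompact_iff]
  have : Units.val '' {u : kˣ | ordZ (u : k) = j} = (ball k j : Set k) \ ball k (j + 1) := by
    ext x
    rw [mem_ball_diff_iff]
    constructor
    · rintro ⟨u, hu, rfl⟩
      exact ⟨u.ne_zero, hu⟩
    · rintro ⟨hx, h⟩
      exact ⟨Units.mk0 x hx, h, rfl⟩
  rw [this]
  exact (isCompact_ball j).diff (isOpen_ball _)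

lemma isClopen_units_ordZ_eq (j : ℤ) : IsClopen {u : kˣ | ordZ (u : k) = j} :=
  isLocallyConstant_ordZ_units.isClopen_fiber j

lemma integerUnits_eq : integerUnits k = {u : kˣ | ordZ (u : k) = 0} :=
  Set.ext fun _ => mem_integerUnits_iff

instance : SecondCountableTopology kˣ := Units.isEmbedding_val₀.secondCountableTopology
instance : LocallyCompactSpace kˣ :=
  (IsOpenUnits.isOpenEmbedding_unitsVal (M := k)).locallyCompactSpace

variable [MeasurableSpace k] [BorelSpace k]

instance borelSpace_units : BorelSpace kˣ := by
  refine ⟨?_⟩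
  rw [Units.isEmbedding_val₀.eq_induced, borel_comap, ← BorelSpace.measurable_eq (α := k)]
  rfl

lemma measurableEmbedding_val : MeasurableEmbedding (Units.val : kˣ → k) :=
  (IsOpenUnits.isOpenEmbedding_unitsVal (M := k)).measurableEmbedding

lemma integrable_of_sphere (ν : Measure kˣ) [ν.IsHaarMeasure] {f : kˣ → ℂ} (hf : Continuous f)
    (j : ℤ) (h : ∀ u : kˣ, ordZ (u : k) ≠ j → f u = 0) : Integrable f ν :=
  hf.integrable_of_hasCompactSupport (HasCompactSupport.intro (isCompact_units_ordZ_eq j) h)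

variable (μ : Measure k) [μ.IsAddHaarMeasure]

/-- The measure `dx / ‖x‖` on `kˣ`; the distributive Haar character of a unit is its modulus. -/
def mulMeasure : Measure kˣ :=
  (μ.comap Units.val).withDensity fun u => ((distribHaarChar k u)⁻¹ : NNReal)

lemma measurable_distribHaarChar : Measurable fun u : kˣ => distribHaarChar k u := by
  have h : (fun u : kˣ => distribHaarChar k u) =
      (fun n : ℤ => (residueCard k : NNReal) ^ (-n)) ∘ fun u : kˣ => ordZ (u : k) := by
    ext u
    simp [distribHaarChar_eq]
  rw [h]
  exact (isLocallyConstant_ordZ_units.comp _).continuous.measurable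

lemma map_mul_left_comap (g : kˣ) :
    (μ.comap Units.val).map (g * ·) = (distribHaarChar k g)⁻¹ • μ.comap Units.val := by
  ext A hA
  rw [Measure.map_apply (measurable_const_mul g) hA, Measure.smul_apply,
    measurableEmbedding_val.comap_apply, measurableEmbedding_val.comap_apply, ← map_inv]
  have h : Units.val '' ((g * ·) ⁻¹' A) = g⁻¹ • (Units.val '' A) := by
    ext x
    rw [Set.mem_smul_set]
    constructor
    · rintro ⟨u, hu, rfl⟩
      exact ⟨_, ⟨g * u, hu, rfl⟩, by simp [Units.smul_def]⟩
    · rintro ⟨_, ⟨u, hu, rfl⟩, rfl⟩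
      exact ⟨g⁻¹ * u, by simpa using hu, by simp [Units.smul_def]⟩
  rw [h, ← distribHaarChar_mul]
  rfl

instance : (mulMeasure μ).IsMulLeftInvariant := by
  refine ⟨fun g => ?_⟩
  ext A hA
  have hm : Measurable fun u : kˣ => (((distribHaarChar k u)⁻¹ : NNReal) : ENNReal) :=
    measurable_distribHaarChar.inv.coe_nnreal_ennreal
  rw [Measure.map_apply (measurable_const_mul g) hA, mulMeasure,
    withDensity_apply _ (measurable_const_mul g hA), withDensity_apply _ hA,
    ← lintegral_indicator (measurable_const_mul g hA), ← lintegral_indicator hA]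
  have h1 : (fun u : kˣ => ((g * ·) ⁻¹' A).indicator
        (fun u => (((distribHaarChar k u)⁻¹ : NNReal) : ENNReal)) u)
      = fun u : kˣ => (fun v => (distribHaarChar k g : ENNReal) * A.indicator
        (fun u => (((distribHaarChar k u)⁻¹ : NNReal) : ENNReal)) v) (g * u) := by
    ext u
    by_cases hu : g * u ∈ A
    · rw [Set.indicator_of_mem (by exact hu)]
      simp only [Set.indicator_of_mem hu]
      rw [← ENNReal.coe_mul, map_mul, mul_inv, mul_inv_cancel_left₀ distribHaarChar_pos.ne']
    · rw [Set.indicator_of_notMem (by exact hu)]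
      simp [Set.indicator_of_notMem hu]
  rw [h1, ← lintegral_map ((hm.indicator hA).const_mul _) (measurable_const_mul g),
    map_mul_left_comap, lintegral_smul_measure, lintegral_const_mul _ (hm.indicator hA),
    ENNReal.smul_def, smul_eq_mul, ← mul_assoc, ← ENNReal.coe_mul,
    inv_mul_cancel₀ distribHaarChar_pos.ne', ENNReal.coe_one, one_mul]

lemma mulMeasure_integerUnits :
    mulMeasure μ (integerUnits k) = μ ((ball k 0 : Set k) \ ball k 1) := by
  have hm : MeasurableSet (integerUnits k) := by
    rw [integerUnits_eq]
    exact (isClopen_units_ordZ_eq 0).isOpen.measurableSet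
  have h1 : ∀ u ∈ integerUnits k, (((distribHaarChar k u)⁻¹ : NNReal) : ENNReal) = 1 := by
    intro u hu
    have : distribHaarChar k u = 1 := NNReal.eq (by
      rw [distribHaarChar_eq, mem_integerUnits_iff.1 hu]
      simp)
    simp [this]
  rw [mulMeasure, withDensity_apply _ hm, setLIntegral_congr_fun hm h1, setLIntegral_one,
    measurableEmbedding_val.comap_apply]
  congr 1
  ext x
  rw [← zero_add (1 : ℤ), mem_ball_diff_iff]
  constructor
  · rintro ⟨u, hu, rfl⟩
    exact ⟨u.ne_zero, mem_integerUnits_iff.1 hu⟩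
  · rintro ⟨hx, h⟩
    exact ⟨Units.mk0 x hx, mem_integerUnits_iff.2 h, rfl⟩

lemma measureReal_ball_diff (j : ℤ) : μ.real ((ball k j : Set k) \ ball k (j + 1)) =
    μ.real (ball k j) - μ.real (ball k (j + 1)) :=
  measureReal_sdiff (ball_anti (by omega)) (measurableSet_ball _) (measure_ball_ne_top μ _)

/-- Multiplicative Haar measure is `dx / ‖x‖`, up to the normalization on the unit group. -/
lemma mulMeasure_eq_smul (ν : Measure kˣ) [ν.IsHaarMeasure] (hν : ν (integerUnits k) = 1) :
    mulMeasure μ = μ ((ball k 0 : Set k) \ ball k 1) • ν := by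
  have hcard : (1 : ℝ) < residueCard k := by exact_mod_cast one_lt_residueCard (k := k)
  have hpos : μ ((ball k 0 : Set k) \ ball k 1) ≠ 0 := by
    have h := measureReal_ball_diff μ (k := k) 0
    rw [zero_add] at h
    intro h0
    rw [measureReal_def, h0, ENNReal.toReal_zero, measureReal_ball μ 1] at h
    have h1 := measureReal_ball_pos μ (k := k) 0
    have h2 : (residueCard k : ℝ) ^ (-1 : ℤ) < 1 := by
      rw [zpow_neg_one]
      exact inv_lt_one_of_one_lt₀ hcard
    nlinarith
  have htop : μ ((ball k 0 : Set k) \ ball k 1) ≠ ⊤ :=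
    ((measure_mono Set.sdiff_subset).trans_lt (measure_ball_ne_top μ 0).lt_top).ne
  rw [← mulMeasure_integerUnits] at hpos htop
  have : (mulMeasure μ).IsHaarMeasure := by
    refine Measure.isHaarMeasure_of_isCompact_nonempty_interior _ (integerUnits k) ?_ ?_ hpos htop
    · rw [integerUnits_eq]
      exact isCompact_units_ordZ_eq 0
    · rw [integerUnits_eq, (isClopen_units_ordZ_eq 0).isOpen.interior_eq]
      exact ⟨1, by simp [ordZ_one]⟩
  have h := Measure.isMulLeftInvariant_eq_smul (mulMeasure μ) ν
  have hc := congrArg (fun m : Measure kˣ => m (integerUnits k)) h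
  simp only [Measure.smul_apply, hν] at hc
  rw [← mulMeasure_integerUnits, hc, ENNReal.smul_def, smul_eq_mul, mul_one]
  exact h

/-- On a part `C` of the sphere `ord x = j`, the measure `ν` is a multiple of `μ`. -/
lemma integral_units_indicator (ν : Measure kˣ) [ν.IsHaarMeasure] (hν : ν (integerUnits k) = 1)
    {C : Set k} (hC : MeasurableSet C) (j : ℤ) (hCj : C ⊆ (ball k j : Set k) \ ball k (j + 1))
    (f : k → ℂ) :
    (μ.real ((ball k 0 : Set k) \ ball k 1) : ℂ) * ∫ t : kˣ, C.indicator f (t : k) ∂ν =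
      (residueCard k : ℂ) ^ j * ∫ x in C, f x ∂μ := by
  have h1 : (μ.real ((ball k 0 : Set k) \ ball k 1) : ℂ) * ∫ t : kˣ, C.indicator f (t : k) ∂ν =
      ∫ t : kˣ, C.indicator f (t : k) ∂(mulMeasure μ) := by
    rw [mulMeasure_eq_smul μ ν hν, integral_smul_measure, Complex.real_smul]
    rfl
  have h2 (t : kˣ) : (distribHaarChar k t)⁻¹ • C.indicator f (t : k) =
      (residueCard k : ℂ) ^ j * C.indicator f (t : k) := by
    by_cases ht : (t : k) ∈ C
    · have := (mem_ball_diff_iff.1 (hCj ht)).2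
      rw [NNReal.smul_def, NNReal.coe_inv, distribHaarChar_eq, this, Complex.real_smul]
      simp
    · simp [Set.indicator_of_notMem ht]
  have h3 : ∫ t : kˣ, C.indicator f (t : k) ∂(mulMeasure μ) =
      ∫ t : kˣ, (distribHaarChar k t)⁻¹ • C.indicator f (t : k) ∂(μ.comap Units.val) :=
    integral_withDensity_eq_integral_smul measurable_distribHaarChar.inv _
  rw [h1, h3]
  simp_rw [h2]
  rw [integral_const_mul, ← measurableEmbedding_val.integral_map (C.indicator f),
    measurableEmbedding_val.map_comap, setIntegral_indicator hC, Set.inter_eq_right.2]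
  intro x hx
  exact ⟨Units.mk0 x (mem_ball_diff_iff.1 (hCj hx)).1, rfl⟩

end Units

/-! ### Schwartz functions, truncation and averaging -/

section Schwartz

variable {k : Type*} [Field k] [ValuativeRel k] [TopologicalSpace k]
  [IsNonarchimedeanLocalField k]

/-- `Φ` vanishes outside the ball `{x | N ≤ ord x}`. -/
def SupportedOn (N : ℤ) (Φ : k → ℂ) : Prop := ∀ x, x ∉ ball k N → Φ x = 0

/-- `Φ` is invariant under translation by the ball `{x | M ≤ ord x}`. -/
def InvariantUnder (M : ℤ) (Φ : k → ℂ) : Prop := ∀ x, ∀ y ∈ ball k M, Φ (x + y) = Φ x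

lemma SupportedOn.mono {N N' : ℤ} {Φ : k → ℂ} (h : SupportedOn N Φ) (hN : N' ≤ N) :
    SupportedOn N' Φ := fun x hx => h x fun hx' => hx (ball_anti hN hx')

lemma InvariantUnder.mono {M M' : ℤ} {Φ : k → ℂ} (h : InvariantUnder M Φ) (hM : M ≤ M') :
    InvariantUnder M' Φ := fun x y hy => h x y (ball_anti hM hy)

lemma InvariantUnder.eq_of_sub_mem {M : ℤ} {Φ : k → ℂ} (h : InvariantUnder M Φ) {x y : k}
    (hxy : y - x ∈ ball k M) : Φ y = Φ x := by
  simpa using h x (y - x) hxy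

lemma InvariantUnder.isLocallyConstant {M : ℤ} {Φ : k → ℂ} (h : InvariantUnder M Φ) :
    IsLocallyConstant Φ := by
  refine (IsLocallyConstant.iff_eventually_eq _).2 fun x => ?_
  have hc : Continuous fun y : k => y - x := continuous_id.sub continuous_const
  refine (hc.continuousAt.eventually_mem ((isOpen_ball M).mem_nhds ?_)).mono
    fun y hy => h.eq_of_sub_mem hy
  rw [sub_self]
  exact zero_mem _

lemma SupportedOn.hasCompactSupport {N : ℤ} {Φ : k → ℂ} (h : SupportedOn N Φ) :
    HasCompactSupport Φ := HasCompactSupport.intro (isCompact_ball N) h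

lemma mem_Sch_of {N M : ℤ} {Φ : k → ℂ} (hN : SupportedOn N Φ) (hM : InvariantUnder M Φ) :
    Φ ∈ Sch k := ⟨hM.isLocallyConstant, hN.hasCompactSupport⟩

lemma exists_ball_of_isCompact {s : Set k} (hs : IsCompact s) :
    ∃ N : ℤ, s ⊆ ball k N := by
  refine hs.induction_on ⟨0, Set.empty_subset _⟩ (fun s t hst ⟨N, h⟩ => ⟨N, hst.trans h⟩)
    (fun s t ⟨N, h⟩ ⟨N', h'⟩ => ⟨min N N', Set.union_subset
      (h.trans (ball_anti (min_le_left _ _))) (h'.trans (ball_anti (min_le_right _ _)))⟩)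
    fun x _ => ?_
  obtain ⟨j, hj⟩ := exists_mem_ball x
  exact ⟨ball k j, mem_nhdsWithin_of_mem_nhds ((isOpen_ball j).mem_nhds hj), j, subset_rfl⟩

lemma exists_supportedOn (Φ : Sch k) : ∃ N, SupportedOn N (Φ : k → ℂ) := by
  obtain ⟨N, hN⟩ := exists_ball_of_isCompact Φ.2.2
  exact ⟨N, fun x hx => image_eq_zero_of_notMem_tsupport fun h => hx (hN h)⟩

/-- A Schwartz function is uniformly locally constant, by compactness of its support. -/
lemma exists_invariantUnder (Φ : Sch k) : ∃ M, InvariantUnder M (Φ : k → ℂ) := by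
  obtain ⟨N, hN⟩ := exists_supportedOn Φ
  have h : ∃ M, ∀ x ∈ (ball k N : Set k), ∀ y ∈ ball k M, (Φ : k → ℂ) (x + y) = (Φ : k → ℂ) x := by
    refine (isCompact_ball N).induction_on ⟨0, by simp⟩
      (fun s t hst ⟨M, h⟩ => ⟨M, fun x hx => h x (hst hx)⟩)
      (fun s t ⟨M, h⟩ ⟨M', h'⟩ => ⟨max M M', ?_⟩) fun x _ => ?_
    · rintro x (hx | hx) y hy
      · exact h x hx y (ball_anti (le_max_left _ _) hy)
      · exact h' x hx y (ball_anti (le_max_right _ _) hy)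
    · have hx := (IsLocallyConstant.iff_eventually_eq _).1 Φ.2.1 x
      have hc : Filter.Tendsto (fun y : k => x + y) (nhds 0) (nhds x) := by
        simpa using (continuous_const_add x).tendsto 0
      obtain ⟨M, hM⟩ := exists_ball_subset (hc.eventually hx)
      have hc' : Continuous fun y : k => y - x := continuous_id.sub continuous_const
      refine ⟨(fun y => y - x) ⁻¹' (ball k M : Set k), mem_nhdsWithin_of_mem_nhds
        (((isOpen_ball M).preimage hc').mem_nhds (by simp)), M, fun z hz y hy => ?_⟩
      have h1 : (Φ : k → ℂ) (x + (z - x)) = (Φ : k → ℂ) x := hM hz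
      have h2 : (Φ : k → ℂ) (x + (z - x + y)) = (Φ : k → ℂ) x := hM (add_mem hz hy)
      rw [add_sub_cancel] at h1
      rw [← add_assoc, add_sub_cancel] at h2
      rw [h1, h2]
  obtain ⟨M, hM⟩ := h
  refine ⟨max M N, fun x y hy => ?_⟩
  by_cases hx : x ∈ ball k N
  · exact hM x hx y (ball_anti (le_max_left _ _) hy)
  · rw [hN x hx, hN]
    rwa [add_mem_cancel_right (ball_anti (le_max_right _ _) hy)]

lemma continuous_Sch (Φ : Sch k) : Continuous (Φ : k → ℂ) := Φ.2.1.continuous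

/-- The function equal to `Φ` on `ball k j` and to `0` elsewhere. -/
def cut (j : ℤ) (Φ : k → ℂ) : k → ℂ := (ball k j : Set k).indicator Φ

lemma cut_of_mem {j : ℤ} {x : k} (hx : x ∈ ball k j) (Φ : k → ℂ) : cut j Φ x = Φ x :=
  Set.indicator_of_mem (by exact hx) Φ

lemma cut_of_notMem {j : ℤ} {x : k} (hx : x ∉ ball k j) (Φ : k → ℂ) : cut j Φ x = 0 :=
  Set.indicator_of_notMem (by exact hx) Φ

lemma cut_mem_Sch (j : ℤ) (Φ : Sch k) : cut j (Φ : k → ℂ) ∈ Sch k := by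
  obtain ⟨M, hM⟩ := exists_invariantUnder Φ
  refine mem_Sch_of (N := j) (M := max M j) (fun x hx => cut_of_notMem hx _) fun x y hy => ?_
  have hyj := ball_anti (le_max_right M j) hy
  by_cases hx : x ∈ ball k j
  · rw [cut_of_mem hx, cut_of_mem (add_mem hx hyj), hM x y (ball_anti (le_max_left _ _) hy)]
  · rw [cut_of_notMem hx, cut_of_notMem]
    rwa [add_mem_cancel_right hyj]

variable [MeasurableSpace k] [BorelSpace k] (μ : Measure k) [μ.IsAddHaarMeasure]

/-- The function whose value at `x` is the mean of `Φ` over `x + ball k j`. -/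
def avg (j : ℤ) (Φ : k → ℂ) (x : k) : ℂ :=
  (μ.real (ball k j) : ℂ)⁻¹ * ∫ y in (ball k j : Set k), Φ (x + y) ∂μ

lemma ballVol_ne_zero (j : ℤ) : (μ.real (ball k j) : ℂ) ≠ 0 :=
  Complex.ofReal_ne_zero.2 (measureReal_ball_pos μ j).ne'

lemma avg_of_forall_eq {j : ℤ} {Φ : k → ℂ} {x : k} {c : ℂ} (h : ∀ y ∈ ball k j, Φ (x + y) = c) :
    avg μ j Φ x = c := by
  rw [avg, setIntegral_congr_fun (g := fun _ => c) (measurableSet_ball j) h, setIntegral_const,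
    Complex.real_smul, inv_mul_cancel_left₀ (ballVol_ne_zero μ j)]

lemma InvariantUnder.avg_eq {j : ℤ} {Φ : k → ℂ} (h : InvariantUnder j Φ) : avg μ j Φ = Φ :=
  funext fun x => avg_of_forall_eq μ (h x)

lemma avg_congr {j : ℤ} {Φ Ψ : k → ℂ} {x x' : k}
    (h : ∀ y ∈ ball k j, Φ (x + y) = Ψ (x' + y)) : avg μ j Φ x = avg μ j Ψ x' := by
  rw [avg, avg, setIntegral_congr_fun (measurableSet_ball j) h]

lemma setIntegral_ball_add (j : ℤ) (f : k → ℂ) {z : k} (hz : z ∈ ball k j) :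
    ∫ y in (ball k j : Set k), f (z + y) ∂μ = ∫ y in (ball k j : Set k), f y ∂μ := by
  rw [← integral_indicator (measurableSet_ball j), ← integral_indicator (measurableSet_ball j),
    ← integral_add_left_eq_self ((ball k j : Set k).indicator f) z]
  congr 1
  ext y
  by_cases hy : y ∈ ball k j
  · rw [Set.indicator_of_mem (by exact hy), Set.indicator_of_mem (by exact add_mem hz hy)]
  · rw [Set.indicator_of_notMem (by exact hy), Set.indicator_of_notMem]
    rwa [SetLike.mem_coe, add_mem_cancel_left hz]

lemma invariantUnder_avg (j : ℤ) (Φ : k → ℂ) : InvariantUnder j (avg μ j Φ) := by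
  intro x z hz
  rw [avg, avg, ← setIntegral_ball_add μ j (fun y => Φ (x + y)) hz]
  simp_rw [add_assoc]

lemma avg_eq_zero {j : ℤ} (Φ : k → ℂ) (hΦ : SupportedOn j Φ) {x : k} (hx : x ∉ ball k j) :
    avg μ j Φ x = 0 :=
  avg_of_forall_eq μ fun y hy => hΦ _ (by rwa [add_mem_cancel_right hy])

lemma supportedOn_avg {j N : ℤ} {Φ : k → ℂ} (hΦ : SupportedOn N Φ) :
    SupportedOn (min j N) (avg μ j Φ) := fun x hx =>
  avg_of_forall_eq μ fun y hy => (hΦ.mono (min_le_right j N)) _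
    (by rwa [add_mem_cancel_right (ball_anti (min_le_left j N) hy)])

lemma avg_of_mem {j : ℤ} (Φ : k → ℂ) {x : k} (hx : x ∈ ball k j) : avg μ j Φ x = avg μ j Φ 0 := by
  simpa using invariantUnder_avg μ j Φ 0 x hx

/-- Truncation and averaging at the same exponent commute: a translate of a ball is either the
ball itself or disjoint from it. -/
lemma avg_cut (j : ℤ) (Φ : k → ℂ) : avg μ j (cut j Φ) = cut j (avg μ j Φ) := by
  ext x
  by_cases hx : x ∈ ball k j
  · rw [cut_of_mem hx]
    exact avg_congr μ fun y hy => cut_of_mem (add_mem hx hy) _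
  · rw [cut_of_notMem hx]
    exact avg_eq_zero μ _ (fun x hx => cut_of_notMem hx _) hx

lemma residueCard_mul_ballVol (j : ℤ) :
    (residueCard k : ℂ) * μ.real (ball k (j + 1)) = μ.real (ball k j) := by
  have h := congrArg ENNReal.toReal (measure_ball_succ μ j)
  rw [ENNReal.toReal_mul, ENNReal.toReal_natCast] at h
  change Measure.real _ _ = _ * Measure.real _ _ at h
  rw [h]
  push_cast
  rfl

lemma residueCard_mul_avg_zero {j : ℤ} {Φ : k → ℂ} (hΦ : SupportedOn (j + 1) Φ) :
    (residueCard k : ℂ) * avg μ j Φ 0 = avg μ (j + 1) Φ 0 := by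
  have h : ∫ y in (ball k j : Set k), Φ (0 + y) ∂μ =
      ∫ y in (ball k (j + 1) : Set k), Φ (0 + y) ∂μ := by
    refine setIntegral_eq_of_subset_of_forall_sdiff_eq_zero (measurableSet_ball j)
      (ball_anti (by omega)) fun y hy => ?_
    rw [zero_add]
    exact hΦ _ hy.2
  have hq : (residueCard k : ℂ) ≠ 0 := residueCard_cast_ne_zero (k := k)
  rw [avg, avg, h, ← residueCard_mul_ballVol μ j, mul_inv, ← mul_assoc, mul_inv_cancel_left₀ hq]

lemma residueCard_mul_avg_cut {j : ℤ} (Φ : k → ℂ) {x : k} (hx : x ∈ ball k j) :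
    (residueCard k : ℂ) * avg μ j (cut (j + 1) Φ) x = avg μ (j + 1) Φ 0 := by
  rw [avg_of_mem μ _ hx, residueCard_mul_avg_zero μ fun x hx => cut_of_notMem hx _, avg_cut,
    cut_of_mem (zero_mem _)]

lemma avg_mem_Sch (j : ℤ) (Φ : Sch k) : avg μ j (Φ : k → ℂ) ∈ Sch k := by
  obtain ⟨N, hN⟩ := exists_supportedOn Φ
  exact mem_Sch_of (supportedOn_avg μ hN) (invariantUnder_avg μ j _)

lemma integrableOn_Sch_add (j : ℤ) (Φ : Sch k) (x : k) :
    IntegrableOn (fun y => (Φ : k → ℂ) (x + y)) (ball k j : Set k) μ :=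
  ((continuous_Sch Φ).comp (continuous_const_add x)).continuousOn.integrableOn_compact
    (isCompact_ball j)

variable (k) in
/-- Truncation as an operator on the Schwartz space. -/
def P (j : ℤ) : Sch k →ₗ[ℂ] Sch k where
  toFun Φ := ⟨cut j Φ, cut_mem_Sch j Φ⟩
  map_add' _ _ := Subtype.ext (Set.indicator_add _ _ _)
  map_smul' c Φ := Subtype.ext (Set.indicator_const_smul _ c (Φ : k → ℂ))

/-- Averaging as an operator on the Schwartz space. -/
def Q (j : ℤ) : Sch k →ₗ[ℂ] Sch k where
  toFun Φ := ⟨avg μ j Φ, avg_mem_Sch μ j Φ⟩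
  map_add' Φ Ψ := Subtype.ext <| funext fun x => by
    simp only [avg, Submodule.coe_add, Pi.add_apply]
    rw [integral_add (integrableOn_Sch_add μ j Φ x) (integrableOn_Sch_add μ j Ψ x), mul_add]
  map_smul' c Φ := Subtype.ext <| funext fun x => by
    simp only [avg, Submodule.coe_smul, Pi.smul_apply, smul_eq_mul, RingHom.id_apply]
    rw [integral_const_mul, mul_left_comm]

lemma Q_P_comm (j : ℤ) (Φ : Sch k) : Q μ j (P k j Φ) = P k j (Q μ j Φ) :=
  Subtype.ext (avg_cut μ j Φ)

end Schwartz

/-! ### The Fourier transform -/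

section Fourier

variable {k : Type*} [Field k] [ValuativeRel k] [TopologicalSpace k]
  [IsNonarchimedeanLocalField k] [MeasurableSpace k] [BorelSpace k]
  {e : AddChar k Circle} {o : ℤ} (μ : Measure k) [μ.IsAddHaarMeasure]

/-- The annihilator of `𝒪` under the character `e` is `ball k (-o)`. -/
def HasConductor (e : AddChar k Circle) (o : ℤ) : Prop :=
  ∀ ξ : k, ξ ∈ ball k (-o) ↔ ∀ y ∈ ball k 0, e (ξ * y) = 1

/-- The annihilator of `ball k j` is `ball k (-j - o)`. -/
lemma HasConductor.mem_dual_iff (ho : HasConductor e o) {j : ℤ} {ξ : k} :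
    ξ ∈ ball k (-j - o) ↔ ∀ y ∈ ball k j, e (ξ * y) = 1 := by
  obtain ⟨a, ha, rfl⟩ := exists_ordZ_eq (k := k) j
  have h1 : ξ ∈ ball k (-ordZ a - o) ↔ a * ξ ∈ ball k (-o) := by
    rw [mul_mem_ball_iff ha, neg_sub_comm]
  rw [h1, ho]
  constructor
  · intro h y hy
    have := h (a⁻¹ * y) (by
      rw [mul_mem_ball_iff (inv_ne_zero ha), ordZ_inv]
      simpa using hy)
    rwa [mul_comm a ξ, mul_assoc, mul_inv_cancel_left₀ ha] at this
  · intro h y hy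
    rw [mul_comm a ξ, mul_assoc]
    exact h _ (by rw [mul_mem_ball_iff ha, sub_self]; exact hy)

lemma fourier_apply (Φ : k → ℂ) (ξ : k) :
    Fourier.fourierIntegral e μ Φ ξ = ∫ x, (e (-(x * ξ)) : ℂ) * Φ x ∂μ := rfl

lemma char_neg_eq_one (ho : HasConductor e o) {j : ℤ} {x y : k} (hx : x ∈ ball k (-j - o))
    (hy : y ∈ ball k j) : e (-(x * y)) = 1 := by
  rw [← neg_mul]
  exact ho.mem_dual_iff.1 (neg_mem hx) y hy

lemma integral_char (ho : HasConductor e o) (j : ℤ) (x : k) :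
    (μ.real (ball k j) : ℂ)⁻¹ * ∫ y in (ball k j : Set k), (e (-(x * y)) : ℂ) ∂μ =
      (ball k (-j - o) : Set k).indicator 1 x := by
  by_cases hx : x ∈ ball k (-j - o)
  · rw [Set.indicator_of_mem (by exact hx), setIntegral_congr_fun (g := fun _ => (1 : ℂ))
      (measurableSet_ball j) fun y hy => by simp [char_neg_eq_one ho hx hy], setIntegral_const,
      Complex.real_smul, inv_mul_cancel_left₀ (ballVol_ne_zero μ j)]
    rfl
  · rw [Set.indicator_of_notMem (by exact hx)]
    have : ∃ z ∈ ball k j, e (-(x * z)) ≠ 1 := by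
      by_contra! h
      refine hx (ho.mem_dual_iff.2 fun y hy => ?_)
      simpa using h (-y) (neg_mem hy)
    -- translating by an element on which the character is nontrivial multiplies the integral
    obtain ⟨z, hz, hne⟩ := this
    have h := setIntegral_ball_add μ j (fun y => (e (-(x * y)) : ℂ)) hz
    simp_rw [mul_add, neg_add, AddChar.map_add_eq_mul, Circle.coe_mul] at h
    rw [integral_const_mul] at h
    have hne' : (e (-(x * z)) : ℂ) ≠ 1 := fun h' => hne (Circle.ext (by simpa using h'))
    rw [(mul_left_eq_self₀.1 h).resolve_left hne', mul_zero]

lemma SupportedOn.invariantUnder_fourier (ho : HasConductor e o) {N : ℤ} {Φ : k → ℂ}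
    (h : SupportedOn N Φ) : InvariantUnder (-N - o) (Fourier.fourierIntegral e μ Φ) := by
  intro ξ η hη
  rw [fourier_apply, fourier_apply]
  congr 1
  ext x
  by_cases hx : x ∈ ball k N
  · rw [mul_add, neg_add, AddChar.map_add_eq_mul, mul_comm x η, char_neg_eq_one ho hη hx, mul_one]
  · rw [h x hx, mul_zero, mul_zero]

lemma InvariantUnder.supportedOn_fourier (ho : HasConductor e o) {M : ℤ} {Φ : k → ℂ}
    (h : InvariantUnder M Φ) : SupportedOn (-M - o) (Fourier.fourierIntegral e μ Φ) := by
  intro ξ hξ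
  have : ∃ y ∈ ball k M, e (ξ * y) ≠ 1 := by
    by_contra! h'
    exact hξ (ho.mem_dual_iff.2 h')
  obtain ⟨y, hy, hne⟩ := this
  have h1 : Fourier.fourierIntegral e μ Φ ξ =
      (e (ξ * y) : ℂ) * Fourier.fourierIntegral e μ Φ ξ := by
    rw [fourier_apply, ← integral_const_mul,
      ← integral_add_right_eq_self (fun x => (e (-(x * ξ)) : ℂ) * Φ x) (-y)]
    congr 1
    ext x
    rw [h x _ (neg_mem hy), add_mul, neg_add, AddChar.map_add_eq_mul, neg_mul, neg_neg,
      mul_comm y ξ, Circle.coe_mul]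
    ring
  have hne' : (e (ξ * y) : ℂ) ≠ 1 := fun h' => hne (Circle.ext (by simpa using h'))
  exact (mul_left_eq_self₀.1 h1.symm).resolve_left hne'

lemma fourier_mem_Sch (ho : HasConductor e o) (Φ : Sch k) :
    Fourier.fourierIntegral e μ (Φ : k → ℂ) ∈ Sch k := by
  obtain ⟨N, hN⟩ := exists_supportedOn Φ
  obtain ⟨M, hM⟩ := exists_invariantUnder Φ
  exact mem_Sch_of (hM.supportedOn_fourier μ ho) (hN.invariantUnder_fourier μ ho)

lemma integrable_char_mul (he : Continuous e) (Φ : Sch k) (ξ : k) :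
    Integrable (fun x => (e (-(x * ξ)) : ℂ) * (Φ : k → ℂ) x) μ := by
  refine Continuous.integrable_of_hasCompactSupport ?_ Φ.2.2.mul_left
  have := continuous_Sch Φ
  fun_prop

/-- The Fourier transform as an operator on the Schwartz space. -/
def fourierOp (he : Continuous e) (ho : HasConductor e o) : Sch k →ₗ[ℂ] Sch k where
  toFun Φ := ⟨Fourier.fourierIntegral e μ Φ, fourier_mem_Sch μ ho Φ⟩
  map_add' Φ Ψ := Subtype.ext <| funext fun ξ => by
    simp only [fourier_apply, Submodule.coe_add, Pi.add_apply, mul_add]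
    exact integral_add (integrable_char_mul μ he Φ ξ) (integrable_char_mul μ he Ψ ξ)
  map_smul' c Φ := Subtype.ext <| funext fun ξ => by
    simp only [fourier_apply, Submodule.coe_smul, Pi.smul_apply, smul_eq_mul, RingHom.id_apply]
    rw [← integral_const_mul]
    simp_rw [mul_left_comm]

/-- Fubini's theorem for an integrand that, for `y` in one ball, vanishes when `x` is
outside another. -/
lemma integral_swap_ball {g : k → k → ℂ} (hg : Continuous (Function.uncurry g)) {N j : ℤ}
    (h : ∀ x, ∀ y ∈ ball k j, x ∉ ball k N → g x y = 0) :
    ∫ x, ∫ y in (ball k j : Set k), g x y ∂μ ∂μ =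
      ∫ y in (ball k j : Set k), ∫ x, g x y ∂μ ∂μ := by
  let f : k → k → ℂ := fun x => (ball k j : Set k).indicator (g x)
  have hf : Function.uncurry f =
      (Set.univ ×ˢ (ball k j : Set k)).indicator (Function.uncurry g) := by
    ext ⟨x, y⟩
    by_cases hy : y ∈ ball k j
    · rw [Set.indicator_of_mem (by exact ⟨trivial, hy⟩)]
      exact Set.indicator_of_mem (by exact hy) _
    · rw [Set.indicator_of_notMem (by exact fun h => hy h.2)]
      exact Set.indicator_of_notMem (by exact hy) _
  have hcont : Continuous (Function.uncurry f) := by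
    rw [hf]
    refine hg.indicator fun a ha => ?_
    rw [(isClopen_univ.prod (isClopen_ball j)).frontier_eq] at ha
    exact ha.elim
  have hsupp : HasCompactSupport (Function.uncurry f) := by
    refine HasCompactSupport.intro ((isCompact_ball N).prod (isCompact_ball j)) ?_
    rintro ⟨x, y⟩ hxy
    by_cases hy : y ∈ ball k j
    · exact (Set.indicator_of_mem (by exact hy) _).trans (h x y hy fun hx => hxy ⟨hx, hy⟩)
    · exact Set.indicator_of_notMem (by exact hy) _
  have := integral_integral_swap_of_hasCompactSupport hcont hsupp (μ := μ) (ν := μ)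
  simp only [f, integral_indicator (measurableSet_ball (k := k) j)] at this
  rw [this, ← integral_indicator (measurableSet_ball j)]
  congr 1
  ext y
  by_cases hy : y ∈ (ball k j : Set k)
  · simp [Set.indicator_of_mem hy]
  · simp [Set.indicator_of_notMem hy]

lemma fourier_avg (he : Continuous e) (ho : HasConductor e o) (j : ℤ) (Φ : Sch k) :
    Fourier.fourierIntegral e μ (avg μ j Φ) =
      cut (-j - o) (Fourier.fourierIntegral e μ (Φ : k → ℂ)) := by
  ext ξ
  by_cases hξ : ξ ∈ ball k (-j - o)
  · obtain ⟨N, hN⟩ := exists_supportedOn Φ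
    have hΦ := continuous_Sch Φ
    rw [cut_of_mem hξ, fourier_apply]
    have h1 (x : k) : (e (-(x * ξ)) : ℂ) * avg μ j Φ x = (μ.real (ball k j) : ℂ)⁻¹ *
        ∫ y in (ball k j : Set k), (e (-(x * ξ)) : ℂ) * (Φ : k → ℂ) (x + y) ∂μ := by
      rw [avg, integral_const_mul, mul_left_comm]
    simp_rw [h1]
    rw [integral_const_mul, integral_swap_ball μ (N := min j N) (by fun_prop)]
    · rw [setIntegral_congr_fun (g := fun _ => Fourier.fourierIntegral e μ (Φ : k → ℂ) ξ)
        (measurableSet_ball j), setIntegral_const, Complex.real_smul,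
        inv_mul_cancel_left₀ (ballVol_ne_zero μ j)]
      intro y hy
      change _ = Fourier.fourierIntegral e μ (Φ : k → ℂ) ξ
      rw [fourier_apply,
        ← integral_add_right_eq_self (fun x => (e (-(x * ξ)) : ℂ) * (Φ : k → ℂ) x) y]
      simp_rw [add_mul, neg_add, AddChar.map_add_eq_mul, mul_comm y ξ, char_neg_eq_one ho hξ hy,
        mul_one]
    · intro x y hy hx
      rw [hN.mono (min_le_right j N), mul_zero]
      rwa [add_mem_cancel_right (ball_anti (min_le_left j N) hy)]
  · rw [cut_of_notMem hξ]
    exact (invariantUnder_avg μ j _).supportedOn_fourier μ ho ξ hξ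

lemma fourier_cut (he : Continuous e) (ho : HasConductor e o) (j : ℤ) (Φ : Sch k) :
    Fourier.fourierIntegral e μ (cut j Φ) =
      avg μ (-j - o) (Fourier.fourierIntegral e μ (Φ : k → ℂ)) := by
  ext ξ
  obtain ⟨N, hN⟩ := exists_supportedOn Φ
  have hΦ := continuous_Sch Φ
  simp only [avg, fourier_apply]
  rw [← integral_swap_ball μ (N := N) (g := fun x η => (e (-(x * (ξ + η))) : ℂ) * (Φ : k → ℂ) x)
    (by fun_prop) (fun x y _ hx => by rw [hN x hx, mul_zero]), ← integral_const_mul]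
  congr 1
  ext x
  have h1 : (fun η => (e (-(x * (ξ + η))) : ℂ) * (Φ : k → ℂ) x) =
      fun η => ((e (-(x * ξ)) : ℂ) * (Φ : k → ℂ) x) * (e (-(x * η)) : ℂ) := by
    ext η
    rw [mul_add, neg_add, AddChar.map_add_eq_mul, Circle.coe_mul]
    ring
  rw [h1, integral_const_mul, mul_left_comm, integral_char μ ho]
  have hj : -(-j - o) - o = j := by ring
  rw [hj]
  by_cases hx : x ∈ ball k j
  · rw [cut_of_mem hx, Set.indicator_of_mem (by exact hx), Pi.one_apply, mul_one]
  · rw [cut_of_notMem hx, Set.indicator_of_notMem (by exact hx), mul_zero, mul_zero]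

lemma fourierOp_Q (he : Continuous e) (ho : HasConductor e o) (j : ℤ) (Φ : Sch k) :
    fourierOp μ he ho (Q μ j Φ) = P k (-j - o) (fourierOp μ he ho Φ) :=
  Subtype.ext (fourier_avg μ he ho j Φ)

lemma fourierOp_P (he : Continuous e) (ho : HasConductor e o) (j : ℤ) (Φ : Sch k) :
    fourierOp μ he ho (P k j Φ) = Q μ (-j - o) (fourierOp μ he ho Φ) :=
  Subtype.ext (fourier_cut μ he ho j Φ)

end Fourier

/-! ### The operator as a locally finite sum of elementary operators -/

section Operator

/-- The indicator of `j < n`. -/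
def ltInd (j n : ℤ) : ℂ := if j < n then 1 else 0

lemma ltInd_of_lt {j n : ℤ} (h : j < n) : ltInd j n = 1 := if_pos h

lemma ltInd_of_le {j n : ℤ} (h : n ≤ j) : ltInd j n = 0 := if_neg h.not_gt

lemma support_ltInd_sub (n : ℤ) :
    (Function.support fun j => ltInd j 0 - ltInd j n) ⊆ Finset.Ico (min 0 n) (max 0 n) := by
  intro j hj
  rw [Finset.coe_Ico, Set.mem_Ico]
  by_contra h
  refine hj ?_
  rcases lt_or_ge j (min 0 n) with h1 | h1
  · simp [ltInd_of_lt (h1.trans_le (min_le_left _ _)), ltInd_of_lt (h1.trans_le (min_le_right _ _))]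
  · have h2 : max 0 n ≤ j := not_lt.1 fun h2 => h ⟨h1, h2⟩
    simp [ltInd_of_le ((le_max_left _ _).trans h2), ltInd_of_le ((le_max_right _ _).trans h2)]

lemma finsum_ltInd_sub (n : ℤ) : ∑ᶠ j, (ltInd j 0 - ltInd j n) = -(n : ℂ) := by
  have h (a : ℤ) (h1 : min 0 n ≤ a) (h2 : a ≤ max 0 n) :
      ∑ j ∈ Finset.Ico (min 0 n) (max 0 n), ltInd j a = ((a - min 0 n : ℤ) : ℂ) := by
    have hf : (Finset.Ico (min 0 n) (max 0 n)).filter (· < a) = Finset.Ico (min 0 n) a := by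
      ext j
      simp only [Finset.mem_filter, Finset.mem_Ico]
      omega
    simp only [ltInd]
    rw [Finset.sum_boole, hf, Int.card_Ico, ← Int.cast_natCast, Int.toNat_of_nonneg (by omega)]
  rw [finsum_eq_sum_of_support_subset _ (support_ltInd_sub n), Finset.sum_sub_distrib,
    h 0 (by omega) (by omega), h n (by omega) (by omega)]
  push_cast
  ring

variable {k : Type*} [Field k] [ValuativeRel k] [TopologicalSpace k]
  [IsNonarchimedeanLocalField k] [MeasurableSpace k] [BorelSpace k]
  (μ : Measure k) [μ.IsAddHaarMeasure]

/-- The elementary operator of exponent `j`. Conjugation by the Fourier transform sends it to the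
negative of the elementary operator of exponent `-1 - o - j`, up to an additive scalar. -/
def elemOp (j : ℤ) : Sch k →ₗ[ℂ] Sch k :=
  ((residueCard k : ℂ) - 1)⁻¹ • (P k j ∘ₗ Q μ j - P k (j + 1) ∘ₗ Q μ (j + 1)
    + (residueCard k : ℂ) • (P k (j + 1) ∘ₗ Q μ j)
    - (residueCard k : ℂ) • (Q μ j ∘ₗ P k (j + 1)))
  + Q μ j - P k (j + 1) - LinearMap.id + (2 * ltInd j 0) • LinearMap.id

lemma elemOp_eq (j : ℤ) (Φ : Sch k) : elemOp μ j Φ =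
    ((residueCard k : ℂ) - 1)⁻¹ • (P k j (Q μ j Φ) - P k (j + 1) (Q μ (j + 1) Φ)
      + (residueCard k : ℂ) • P k (j + 1) (Q μ j Φ) - (residueCard k : ℂ) • Q μ j (P k (j + 1) Φ))
    + Q μ j Φ - P k (j + 1) Φ - Φ + (2 * ltInd j 0) • Φ := rfl

/-- The mean of `Φ` over the sphere `ord x = j`, expressed through its means over the two balls
of which the sphere is the difference. -/
def sphereMean (j : ℤ) (Φ : k → ℂ) : ℂ :=
  ((residueCard k : ℂ) - 1)⁻¹ * (residueCard k * avg μ j Φ 0 - avg μ (j + 1) Φ 0)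

lemma residueCard_sub_one_ne_zero : (residueCard k : ℂ) - 1 ≠ 0 := by
  rw [sub_ne_zero]
  exact_mod_cast (one_lt_residueCard (k := k)).ne'

lemma elemOp_apply (j : ℤ) (Φ : Sch k) (x : k) : (elemOp μ j Φ : k → ℂ) x =
    ((residueCard k : ℂ) - 1)⁻¹ * (cut j (avg μ j Φ) x - cut (j + 1) (avg μ (j + 1) Φ) x
      + residueCard k * cut (j + 1) (avg μ j Φ) x - residueCard k * avg μ j (cut (j + 1) Φ) x)
    + avg μ j Φ x - cut (j + 1) (Φ : k → ℂ) x - (Φ : k → ℂ) x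
    + 2 * ltInd j 0 * (Φ : k → ℂ) x := rfl

lemma elemOp_apply_of_mem {j : ℤ} (Φ : Sch k) {x : k} (hx : x ∈ ball k (j + 1)) :
    (elemOp μ j Φ : k → ℂ) x =
      2 * (sphereMean μ j Φ - (Φ : k → ℂ) x + ltInd j 0 * (Φ : k → ℂ) x) := by
  have hx' : x ∈ ball k j := ball_anti (by omega) hx
  have hq := residueCard_sub_one_ne_zero (k := k)
  rw [elemOp_apply, cut_of_mem hx', cut_of_mem hx, cut_of_mem hx, cut_of_mem hx,
    residueCard_mul_avg_cut μ _ hx', avg_of_mem μ _ hx', avg_of_mem μ _ hx, sphereMean]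
  field_simp
  ring

lemma elemOp_apply_of_sphere {j : ℤ} (Φ : Sch k) {x : k} (hx : x ∈ ball k j)
    (hx' : x ∉ ball k (j + 1)) :
    (elemOp μ j Φ : k → ℂ) x =
      sphereMean μ j Φ - (Φ : k → ℂ) x + 2 * ltInd j 0 * (Φ : k → ℂ) x := by
  have hq := residueCard_sub_one_ne_zero (k := k)
  rw [elemOp_apply, cut_of_mem hx, cut_of_notMem hx', cut_of_notMem hx', cut_of_notMem hx',
    residueCard_mul_avg_cut μ _ hx, avg_of_mem μ _ hx, sphereMean]
  field_simp
  ring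

lemma elemOp_apply_of_notMem {j : ℤ} (Φ : Sch k) {x : k} (hx : x ∉ ball k j) :
    (elemOp μ j Φ : k → ℂ) x =
      avg μ j Φ x - (Φ : k → ℂ) x + 2 * ltInd j 0 * (Φ : k → ℂ) x := by
  have hx' : x ∉ ball k (j + 1) := fun h => hx (ball_anti (by omega) h)
  rw [elemOp_apply, cut_of_notMem hx, cut_of_notMem hx', cut_of_notMem hx', cut_of_notMem hx',
    avg_eq_zero μ _ (fun y hy => cut_of_notMem (fun h => hy (ball_anti (by omega) h)) _) hx]
  ring

lemma sphereMean_of_invariantUnder {j : ℤ} {Φ : k → ℂ} (h : InvariantUnder j Φ) :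
    sphereMean μ j Φ = Φ 0 := by
  have hq := residueCard_sub_one_ne_zero (k := k)
  rw [sphereMean, h.avg_eq μ, (h.mono (by omega)).avg_eq μ]
  field_simp

lemma sphereMean_of_supportedOn {j : ℤ} {Φ : k → ℂ} (h : SupportedOn (j + 1) Φ) :
    sphereMean μ j Φ = 0 := by
  rw [sphereMean, residueCard_mul_avg_zero μ h, sub_self, mul_zero]

lemma elemOp_eq_zero_of_invariantUnder {j : ℤ} (hj : 0 ≤ j) {Φ : Sch k}
    (h : InvariantUnder j (Φ : k → ℂ)) : elemOp μ j Φ = 0 := by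
  refine Subtype.ext (funext fun x => ?_)
  have h0 : x ∈ ball k j → (Φ : k → ℂ) x = (Φ : k → ℂ) 0 := fun hx =>
    h.eq_of_sub_mem (by simpa using hx)
  by_cases hx : x ∈ ball k j
  · by_cases hx' : x ∈ ball k (j + 1)
    · rw [elemOp_apply_of_mem μ Φ hx', sphereMean_of_invariantUnder μ h, h0 hx, ltInd_of_le hj]
      simp
    · rw [elemOp_apply_of_sphere μ Φ hx hx', sphereMean_of_invariantUnder μ h, h0 hx,
        ltInd_of_le hj]
      simp
  · rw [elemOp_apply_of_notMem μ Φ hx, h.avg_eq μ, ltInd_of_le hj]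
    simp

lemma elemOp_eq_zero_of_supportedOn {j : ℤ} (hj : j < 0) {Φ : Sch k}
    (h : SupportedOn (j + 1) (Φ : k → ℂ)) : elemOp μ j Φ = 0 := by
  refine Subtype.ext (funext fun x => ?_)
  by_cases hx' : x ∈ ball k (j + 1)
  · rw [elemOp_apply_of_mem μ Φ hx', sphereMean_of_supportedOn μ h, ltInd_of_lt hj]
    simp
  · by_cases hx : x ∈ ball k j
    · rw [elemOp_apply_of_sphere μ Φ hx hx', sphereMean_of_supportedOn μ h, h x hx']
      simp
    · rw [elemOp_apply_of_notMem μ Φ hx, avg_eq_zero μ _ (h.mono (by omega)) hx, h x hx']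
      simp

lemma exists_bound (Φ : Sch k) : ∃ L : ℤ, 0 ≤ L ∧ ∀ L', L ≤ L' →
    SupportedOn (-L') (Φ : k → ℂ) ∧ InvariantUnder L' (Φ : k → ℂ) := by
  obtain ⟨N, hN⟩ := exists_supportedOn Φ
  obtain ⟨M, hM⟩ := exists_invariantUnder Φ
  exact ⟨max 0 (max (-N) M), le_max_left _ _, fun L' h => ⟨hN.mono (by omega), hM.mono (by omega)⟩⟩

lemma elemOp_eq_zero {L : ℤ} (hL : 0 ≤ L) {Φ : Sch k} (hN : SupportedOn (-L) (Φ : k → ℂ))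
    (hM : InvariantUnder L (Φ : k → ℂ)) {j : ℤ} (hj : j ∉ Finset.Icc (-L) L) :
    elemOp μ j Φ = 0 := by
  rw [Finset.mem_Icc, not_and_or] at hj
  rcases hj with hj | hj
  · exact elemOp_eq_zero_of_supportedOn μ (by omega) (hN.mono (by omega))
  · exact elemOp_eq_zero_of_invariantUnder μ (by omega) (hM.mono (by omega))

lemma finite_support_elemOp (Φ : Sch k) : (Function.support fun j => elemOp μ j Φ).Finite := by
  obtain ⟨L, hL, h⟩ := exists_bound Φ
  obtain ⟨hN, hM⟩ := h L le_rfl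
  refine (Finset.Icc (-L) L).finite_toSet.subset fun j hj => ?_
  by_contra hj'
  exact hj (elemOp_eq_zero μ hL hN hM hj')

/-- The operator `K` for a character of conductor exponent `o`: half of the difference between the
locally finite sum of the elementary operators and the scalar `o`. -/
def stirlingOp (o : ℤ) : Sch k →ₗ[ℂ] Sch k where
  toFun Φ := (-(o : ℂ) / 2) • Φ + (1 / 2 : ℂ) • ∑ᶠ j, elemOp μ j Φ
  map_add' Φ Ψ := by
    simp only [map_add]
    rw [finsum_add_distrib (finite_support_elemOp μ Φ) (finite_support_elemOp μ Ψ)]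
    module
  map_smul' c Φ := by
    simp only [map_smul, RingHom.id_apply]
    rw [← smul_finsum' c (finite_support_elemOp μ Φ)]
    module

lemma stirlingOp_apply (o : ℤ) (Φ : Sch k) :
    stirlingOp μ o Φ = (-(o : ℂ) / 2) • Φ + (1 / 2 : ℂ) • ∑ᶠ j, elemOp μ j Φ := rfl

variable {e : AddChar k Circle} {o : ℤ}

lemma fourierOp_elemOp (he : Continuous e) (ho : HasConductor e o) (j : ℤ) (Φ : Sch k) :
    fourierOp μ he ho (elemOp μ j Φ) = -elemOp μ (-1 - o - j) (fourierOp μ he ho Φ)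
      + (2 * (ltInd j 0 - ltInd j (-o))) • fourierOp μ he ho Φ := by
  set i := -1 - o - j with hi
  set F := fourierOp μ he ho
  have hdual : -j - o = i + 1 := by omega
  have hdual' : -(j + 1) - o = i := by omega
  have hQ (Φ : Sch k) : F (Q μ j Φ) = P k (i + 1) (F Φ) := hdual ▸ fourierOp_Q μ he ho j Φ
  have hP (Φ : Sch k) : F (P k j Φ) = Q μ (i + 1) (F Φ) := hdual ▸ fourierOp_P μ he ho j Φ
  have hQ' (Φ : Sch k) : F (Q μ (j + 1) Φ) = P k i (F Φ) := hdual' ▸ fourierOp_Q μ he ho _ Φ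
  have hP' (Φ : Sch k) : F (P k (j + 1) Φ) = Q μ i (F Φ) := hdual' ▸ fourierOp_P μ he ho _ Φ
  have hind : ltInd i 0 = 1 - ltInd j (-o) := by
    rcases lt_or_ge j (-o) with h | h
    · rw [ltInd_of_lt h, ltInd_of_le (by omega), sub_self]
    · rw [ltInd_of_le h, ltInd_of_lt (by omega), sub_zero]
  simp only [elemOp_eq, map_add, map_sub, map_smul, hQ, hP, hQ', hP', Q_P_comm, hind]
  module

/-- The operator `K` anticommutes with the Fourier transform: the elementary operators are
permuted up to sign, and the scalars left over add up to the conductor exponent. -/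
lemma stirlingOp_fourierOp (he : Continuous e) (ho : HasConductor e o) (Φ : Sch k) :
    stirlingOp μ o (fourierOp μ he ho Φ) = -fourierOp μ he ho (stirlingOp μ o Φ) := by
  set F := fourierOp μ he ho
  have hterm (j : ℤ) : F (elemOp μ j Φ) = -elemOp μ (-1 - o - j) (F Φ)
      + (2 * (ltInd j 0 - ltInd j (-o))) • F Φ :=
    fourierOp_elemOp μ he ho j Φ
  have hfin : (Function.support fun j => -elemOp μ (-1 - o - j) (F Φ)).Finite := by
    have h : (fun j => -elemOp μ (-1 - o - j) (F Φ)) =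
        (fun j => -elemOp μ j (F Φ)) ∘ Equiv.subLeft (-1 - o) := rfl
    rw [h, Function.support_comp_eq_preimage, Function.support_fun_neg]
    exact (finite_support_elemOp μ (F Φ)).preimage (Equiv.injective _).injOn
  have hfin' : (Function.support fun j => (2 * (ltInd j 0 - ltInd j (-o))) • F Φ).Finite := by
    refine (Finset.finite_toSet _).subset (Set.Subset.trans ?_ (support_ltInd_sub (-o)))
    intro j hj h0
    simp only at h0
    simp [h0] at hj
  have h1 : ∑ᶠ j, (2 * (ltInd j 0 - ltInd j (-o))) • F Φ = (2 * (o : ℂ)) • F Φ := by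
    have hs : (Function.support fun j => 2 * (ltInd j 0 - ltInd j (-o))).Finite := by
      refine (Finset.finite_toSet _).subset (Set.Subset.trans ?_ (support_ltInd_sub (-o)))
      intro j hj h0
      simp only at h0
      simp [h0] at hj
    rw [← finsum_smul' hs, ← mul_finsum, finsum_ltInd_sub]
    push_cast
    rw [neg_neg]
  have h2 : ∑ᶠ j, -elemOp μ (-1 - o - j) (F Φ) = -∑ᶠ j, elemOp μ j (F Φ) := by
    rw [finsum_neg_distrib,
      ← finsum_comp_equiv (Equiv.subLeft (-1 - o)) (f := fun j => elemOp μ j (F Φ))]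
    rfl
  have hsum : F (∑ᶠ j, elemOp μ j Φ) = -∑ᶠ j, elemOp μ j (F Φ) + (2 * (o : ℂ)) • F Φ := by
    rw [map_finsum F (finite_support_elemOp μ Φ)]
    simp_rw [hterm]
    rw [finsum_add_distrib hfin hfin', h1, h2]
  rw [stirlingOp_apply, stirlingOp_apply, map_add, map_smul, map_smul, hsum]
  module

end Operator

/-! ### Integrals over spheres and balls in the multiplicative group -/

section Formula

variable {k : Type*} [Field k] [ValuativeRel k] [TopologicalSpace k]
  [IsNonarchimedeanLocalField k] [MeasurableSpace k] [BorelSpace k]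
  (μ : Measure k) [μ.IsAddHaarMeasure] (ν : Measure kˣ) [ν.IsHaarMeasure]

lemma ballVol_eq (j : ℤ) :
    (μ.real (ball k j) : ℂ) = (residueCard k : ℂ) ^ (-j) * μ.real (ball k 0) := by
  rw [measureReal_ball]
  push_cast
  rfl

lemma unitVol_eq : (μ.real ((ball k 0 : Set k) \ ball k 1) : ℂ) =
    (1 - (residueCard k : ℂ)⁻¹) * μ.real (ball k 0) := by
  have h := measureReal_ball_diff μ (k := k) 0
  rw [zero_add] at h
  rw [h, Complex.ofReal_sub, ballVol_eq μ 1, zpow_neg_one]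
  ring

lemma one_sub_inv_residueCard_ne_zero : 1 - (residueCard k : ℂ)⁻¹ ≠ 0 := by
  have hq : (residueCard k : ℂ) ≠ 0 := residueCard_cast_ne_zero (k := k)
  have hq1 := residueCard_sub_one_ne_zero (k := k)
  rw [← mul_ne_zero_iff_left hq, mul_sub, mul_inv_cancel₀ hq, mul_one]
  exact hq1

lemma setIntegral_ball (j : ℤ) (f : k → ℂ) :
    ∫ y in (ball k j : Set k), f y ∂μ = μ.real (ball k j) * avg μ j f 0 := by
  simp only [avg, zero_add]
  rw [mul_inv_cancel_left₀ (ballVol_ne_zero μ j)]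

/-- The multiplicative Haar measure of each sphere being `1`, the integral over a sphere is the
mean. -/
lemma integral_sphere (hν : ν (integerUnits k) = 1) {f : k → ℂ} (hf : Continuous f) (j : ℤ) :
    ∫ t : kˣ, (if ordZ (t : k) = j then f t else 0) ∂ν = sphereMean μ j f := by
  have hq : (residueCard k : ℂ) ≠ 0 := residueCard_cast_ne_zero (k := k)
  have hq1 := residueCard_sub_one_ne_zero (k := k)
  have hV := ballVol_ne_zero μ (k := k) 0
  have h := integral_units_indicator μ ν hν
    (C := (ball k j : Set k) \ ball k (j + 1)) ((measurableSet_ball j).diff (measurableSet_ball _))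
    j subset_rfl f
  have h1 (t : kˣ) : ((ball k j : Set k) \ ball k (j + 1)).indicator f (t : k) =
      if ordZ (t : k) = j then f t else 0 := by
    classical
    rw [Set.indicator_apply]
    simp only [mem_ball_diff_iff, t.ne_zero, ne_eq, not_false_eq_true, true_and]
  have h2 : ∫ x in (ball k j : Set k) \ ball k (j + 1), f x ∂μ =
      ∫ x in (ball k j : Set k), f x ∂μ - ∫ x in (ball k (j + 1) : Set k), f x ∂μ :=
    setIntegral_sdiff (measurableSet_ball _)
      (hf.continuousOn.integrableOn_compact (isCompact_ball j)) (ball_anti (by omega))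
  simp_rw [h1] at h
  rw [h2, setIntegral_ball, setIntegral_ball, ballVol_eq μ j, ballVol_eq μ (j + 1), unitVol_eq,
    neg_add, zpow_add₀ hq, zpow_neg, zpow_neg_one] at h
  have hj : (residueCard k : ℂ) ^ j ≠ 0 := zpow_ne_zero _ hq
  have hc : (1 - (residueCard k : ℂ)⁻¹) * (μ.real (ball k 0) : ℂ) ≠ 0 :=
    mul_ne_zero one_sub_inv_residueCard_ne_zero hV
  refine mul_left_cancel₀ hc (h.trans ?_)
  rw [sphereMean]
  field_simp

lemma map_mul_left (u : kˣ) :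
    μ.map (fun y => (u : k) * y) = (distribHaarChar k u)⁻¹ • μ := by
  ext A hA
  rw [Measure.map_apply (measurable_const_mul _) hA, Measure.smul_apply, ← map_inv]
  have h : (fun y => (u : k) * y) ⁻¹' A = u⁻¹ • A := by
    ext x
    rw [Set.mem_inv_smul_set_iff]
    rfl
  rw [h, ← distribHaarChar_mul]
  rfl

/-- Averages are compatible with dilation. -/
lemma avg_dilate {x : k} (hx : x ≠ 0) (i : ℤ) (f : k → ℂ) (z : k) :
    avg μ i (fun y => f (z + x * y)) 0 = avg μ (ordZ x + i) f z := by
  have hq : (residueCard k : ℂ) ≠ 0 := residueCard_cast_ne_zero (k := k)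
  have he : MeasurableEmbedding fun y : k => x * y :=
    (Homeomorph.mulLeft₀ x hx).measurableEmbedding
  have h := he.integral_map (μ := μ) ((ball k (ordZ x + i) : Set k).indicator fun y => f (z + y))
  have hind (y : k) : (ball k (ordZ x + i) : Set k).indicator (fun y => f (z + y)) (x * y) =
      (ball k i : Set k).indicator (fun y => f (z + x * y)) y := by
    have hmem : x * y ∈ ball k (ordZ x + i) ↔ y ∈ ball k i := by
      rw [mul_mem_ball_iff hx, add_sub_cancel_left]
    by_cases hy : y ∈ ball k i
    · rw [Set.indicator_of_mem (by exact hmem.2 hy), Set.indicator_of_mem (by exact hy)]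
    · rw [Set.indicator_of_notMem (by exact fun h => hy (hmem.1 h)),
        Set.indicator_of_notMem (by exact hy)]
  simp_rw [hind] at h
  have hmap := map_mul_left μ (Units.mk0 x hx)
  rw [Units.val_mk0] at hmap
  rw [hmap, integral_smul_nnreal_measure, integral_indicator (measurableSet_ball _),
    integral_indicator (measurableSet_ball _), NNReal.smul_def, NNReal.coe_inv,
    distribHaarChar_eq, Units.val_mk0, Complex.real_smul] at h
  simp only [avg, zero_add]
  rw [← h, ballVol_eq μ i, ballVol_eq μ (ordZ x + i), neg_add, zpow_add₀ hq]
  push_cast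
  rw [mul_inv, mul_inv, mul_inv]
  ring

lemma continuous_ordZ_ite (j : ℤ) (c : ℂ) :
    Continuous fun t : kˣ => if ordZ (t : k) = j then c else 0 :=
  (isLocallyConstant_ordZ_units.comp fun n => if n = j then c else 0).continuous

lemma integrable_sphere {f : k → ℂ} (hf : Continuous f) (j : ℤ) :
    Integrable (fun t : kˣ => if ordZ (t : k) = j then f t else 0) ν := by
  refine integrable_of_sphere ν ?_ j fun u hu => if_neg hu
  have h : (fun t : kˣ => if ordZ (t : k) = j then f t else 0) =
      fun t : kˣ => (if ordZ (t : k) = j then 1 else 0) * f t := by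
    ext t
    split_ifs <;> simp
  rw [h]
  exact (continuous_ordZ_ite j 1).mul (hf.comp Units.continuous_val)

/-! ### The value of the operator at the origin -/

/-- The part of the integrand of `M^{(1)}` that lives on the sphere `ord t = j`. -/
def mLayer (Φ : k → ℂ) (j : ℤ) (t : kˣ) : ℂ :=
  if ordZ (t : k) = j then Φ t - (1 - ltInd j 0) * Φ 0 else 0

lemma integrable_mLayer (Φ : Sch k) (j : ℤ) : Integrable (mLayer (Φ : k → ℂ) j) ν :=
  integrable_sphere ν (f := fun t => (Φ : k → ℂ) t - (1 - ltInd j 0) * (Φ : k → ℂ) 0)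
    ((continuous_Sch Φ).sub continuous_const) j

lemma two_mul_integral_mLayer (hν : ν (integerUnits k) = 1) (Φ : Sch k) (j : ℤ) :
    2 * ∫ t, mLayer (Φ : k → ℂ) j t ∂ν = (elemOp μ j Φ : k → ℂ) 0 := by
  have h : mLayer (Φ : k → ℂ) j = fun t : kˣ =>
      (if ordZ (t : k) = j then (Φ : k → ℂ) t else 0)
        - (if ordZ (t : k) = j then (1 - ltInd j 0) * (Φ : k → ℂ) 0 else 0) := by
    ext t
    rw [mLayer]
    split_ifs <;> simp
  rw [h, integral_sub (integrable_sphere ν (continuous_Sch Φ) j)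
    (integrable_sphere ν (f := fun _ => _) continuous_const j),
    integral_sphere μ ν hν (continuous_Sch Φ),
    integral_sphere μ ν hν (f := fun _ => (1 - ltInd j 0) * (Φ : k → ℂ) 0) continuous_const,
    sphereMean_of_invariantUnder μ (Φ := fun _ => (1 - ltInd j 0) * (Φ : k → ℂ) 0)
      (fun _ _ _ => rfl), elemOp_apply_of_mem μ Φ (zero_mem _)]
  ring

lemma sum_mLayer {L : ℤ} (hL : 0 ≤ L) {Φ : k → ℂ} (hN : SupportedOn (-L) Φ)
    (hM : InvariantUnder L Φ) (t : kˣ) :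
    ∑ j ∈ Finset.Icc (-L) L, mLayer Φ j t = mIntegrand 1 Φ t := by
  have h1 : (dilate ((1 : kˣ) : k)).indicator 1 (t : k) = 1 - ltInd (ordZ (t : k)) 0 := by
    rw [Units.val_one, dilate_eq_ball one_ne_zero, ordZ_one]
    by_cases h : 0 ≤ ordZ (t : k)
    · rw [Set.indicator_of_mem (by exact (mem_ball_iff t.ne_zero).2 h), ltInd_of_le h, sub_zero]
      rfl
    · rw [Set.indicator_of_notMem (by exact fun h' => h ((mem_ball_iff t.ne_zero).1 h')),
        ltInd_of_lt (not_le.1 h), sub_self]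
  simp only [mLayer]
  rw [mIntegrand, h1, Finset.sum_ite_eq]
  split_ifs with h
  · rfl
  · rw [Finset.mem_Icc, not_and_or, not_le, not_le] at h
    rcases h with h | h
    · rw [hN _ (by rw [mem_ball_iff t.ne_zero]; omega), ltInd_of_lt (by omega)]
      simp
    · rw [ltInd_of_le (by omega), hM.eq_of_sub_mem (x := 0) (y := t)]
      · simp
      · rw [sub_zero, mem_ball_iff t.ne_zero]
        omega

lemma integrable_mIntegrand (Φ : Sch k) : Integrable (mIntegrand 1 (Φ : k → ℂ)) ν := by
  obtain ⟨L, hL, h⟩ := exists_bound Φ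
  obtain ⟨hN, hM⟩ := h L le_rfl
  rw [← funext (sum_mLayer hL hN hM)]
  exact integrable_finsetSum _ fun j _ => integrable_mLayer ν Φ j

lemma finsum_elemOp_apply {L : ℤ} (hL : 0 ≤ L) {Φ : Sch k} (hN : SupportedOn (-L) (Φ : k → ℂ))
    (hM : InvariantUnder L (Φ : k → ℂ)) (x : k) :
    ((∑ᶠ j, elemOp μ j Φ : Sch k) : k → ℂ) x =
      ∑ j ∈ Finset.Icc (-L) L, (elemOp μ j Φ : k → ℂ) x := by
  rw [finsum_eq_sum_of_support_subset (s := Finset.Icc (-L) L), Submodule.coe_sum,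
    Finset.sum_apply]
  intro j hj
  by_contra hj'
  exact hj (elemOp_eq_zero μ hL hN hM hj')

lemma finsum_elemOp_zero (hν : ν (integerUnits k) = 1) (Φ : Sch k) :
    ((∑ᶠ j, elemOp μ j Φ : Sch k) : k → ℂ) 0 = 2 * M ν 1 Φ := by
  obtain ⟨L, hL, h⟩ := exists_bound Φ
  obtain ⟨hN, hM⟩ := h L le_rfl
  rw [finsum_elemOp_apply μ hL hN hM, M, ← funext (sum_mLayer hL hN hM),
    integral_finsetSum _ fun j _ => integrable_mLayer ν Φ j, Finset.mul_sum]
  exact Finset.sum_congr rfl fun j _ => (two_mul_integral_mLayer μ ν hν Φ j).symm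

/-! ### The value of the operator away from the origin -/

/-- The contribution of exponent `j` to the integrand of `L⁺[Φ](x)`: the exponents below `ord x`
give the spheres `ord (x t) = j`, and the others a decomposition of `‖t - 1‖⁻¹` on the unit group
into indicators of the balls `ord (t - 1) ≥ j - ord x`. -/
def lLayer (Φ : k → ℂ) (x : k) (j : ℤ) (t : kˣ) : ℂ :=
  if j < ordZ x then (if ordZ (t : k) = j - ordZ x then Φ (x * t) else 0)
  else if j = ordZ x then (1 / 2) * (if ordZ (t : k) = 0 then Φ (x * t) - Φ x else 0)
  else (1 / 2) * ((residueCard k : ℂ) ^ (j - ordZ x) - (residueCard k : ℂ) ^ (j - ordZ x - 1)) *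
    ({s : k | s - 1 ∈ ball k (j - ordZ x)}.indicator (fun s => Φ (x * s) - Φ x) (t : k))

lemma ordZ_eq_zero_of_sub_one_mem {i : ℤ} (hi : 0 < i) {s : k} (hs : s - 1 ∈ ball k i) :
    s ≠ 0 ∧ ordZ s = 0 := by
  have h := ordZ_eq_of_sub_mem (x := (1 : k)) (y := s) one_ne_zero
    (by rw [ordZ_one]; exact ball_anti (by omega) hs)
  rwa [ordZ_one] at h

lemma continuous_mul_Sch (Φ : Sch k) (x : k) : Continuous fun s : k => (Φ : k → ℂ) (x * s) :=
  (continuous_Sch Φ).comp (continuous_const_mul x)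

lemma isClopen_near_one (i : ℤ) : IsClopen {s : k | s - 1 ∈ ball k i} :=
  (isClopen_ball i).preimage (continuous_id.sub continuous_const)

lemma integrable_near_one (Φ : Sch k) (x : k) {i : ℤ} (hi : 0 < i) :
    Integrable (fun t : kˣ => {s : k | s - 1 ∈ ball k i}.indicator
      (fun s => (Φ : k → ℂ) (x * s) - (Φ : k → ℂ) x) (t : k)) ν := by
  have hc : Continuous ({s : k | s - 1 ∈ ball k i}.indicator
      (fun s => (Φ : k → ℂ) (x * s) - (Φ : k → ℂ) x)) := by
    refine ((continuous_mul_Sch Φ x).sub continuous_const).indicator fun a ha => ?_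
    rw [(isClopen_near_one i).frontier_eq] at ha
    exact ha.elim
  refine integrable_of_sphere ν (hc.comp Units.continuous_val) 0 fun u hu => ?_
  rw [Set.indicator_of_notMem]
  exact fun hs => hu (ordZ_eq_zero_of_sub_one_mem hi hs).2

lemma integrable_lLayer (Φ : Sch k) (x : k) (j : ℤ) :
    Integrable (lLayer (Φ : k → ℂ) x j) ν := by
  have hΦ := continuous_mul_Sch Φ x
  unfold lLayer
  rcases lt_trichotomy j (ordZ x) with h | h | h
  · simp only [if_pos h]
    exact integrable_sphere ν hΦ _
  · simp only [h, lt_irrefl, if_false, if_true]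
    exact (integrable_sphere ν (f := fun s => (Φ : k → ℂ) (x * s) - (Φ : k → ℂ) x)
      (hΦ.sub continuous_const) 0).const_mul _
  · simp only [if_neg h.not_gt, if_neg h.ne']
    exact (integrable_near_one ν Φ x (by omega)).const_mul _

/-- The weight `q ^ i - q ^ (i - 1)` is the inverse of the measure of `1 + ball k i`, so that the
integral over that ball becomes an additive mean. -/
lemma integral_near_one (hν : ν (integerUnits k) = 1) (Φ : Sch k) {x : k} (hx : x ≠ 0) {i : ℤ}
    (hi : 0 < i) :
    ((residueCard k : ℂ) ^ i - (residueCard k : ℂ) ^ (i - 1)) *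
      ∫ t : kˣ, {s : k | s - 1 ∈ ball k i}.indicator
        (fun s => (Φ : k → ℂ) (x * s) - (Φ : k → ℂ) x) (t : k) ∂ν =
      avg μ (ordZ x + i) Φ x - (Φ : k → ℂ) x := by
  have hq : (residueCard k : ℂ) ≠ 0 := residueCard_cast_ne_zero (k := k)
  have hV := ballVol_ne_zero μ (k := k) 0
  have hC : MeasurableSet {s : k | s - 1 ∈ ball k i} := (isClopen_near_one i).isOpen.measurableSet
  have hCs : {s : k | s - 1 ∈ ball k i} ⊆ (ball k 0 : Set k) \ ball k (0 + 1) := fun s hs =>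
    mem_ball_diff_iff.2 (ordZ_eq_zero_of_sub_one_mem hi hs)
  have h := integral_units_indicator μ ν hν hC 0 hCs
    (fun s => (Φ : k → ℂ) (x * s) - (Φ : k → ℂ) x)
  have h1 : ∫ s in {s : k | s - 1 ∈ ball k i}, ((Φ : k → ℂ) (x * s) - (Φ : k → ℂ) x) ∂μ =
      ∫ y in (ball k i : Set k), ((Φ : k → ℂ) (x + x * y) - (Φ : k → ℂ) x) ∂μ := by
    rw [← integral_indicator hC, ← integral_indicator (measurableSet_ball i),
      ← integral_add_right_eq_self _ (1 : k)]
    congr 1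
    ext y
    have hy : x * (y + 1) = x + x * y := by ring
    by_cases h : y ∈ ball k i
    · rw [Set.indicator_of_mem (by simpa using h), Set.indicator_of_mem (by exact h), hy]
    · rw [Set.indicator_of_notMem (by simpa using h), Set.indicator_of_notMem (by exact h)]
  have hint : IntegrableOn (fun y => (Φ : k → ℂ) (x + x * y)) (ball k i : Set k) μ :=
    ((continuous_Sch Φ).comp (continuous_const.add
      (continuous_const_mul x))).continuousOn.integrableOn_compact (isCompact_ball i)
  rw [h1, integral_sub hint (integrable_const_iff.2 (Or.inr ⟨by
      simpa using (measure_ball_ne_top μ i).lt_top⟩)), setIntegral_ball,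
    avg_dilate μ hx i Φ x, setIntegral_const, Complex.real_smul, unitVol_eq, ballVol_eq μ i,
    zpow_zero, one_mul] at h
  have hi' : (residueCard k : ℂ) ^ i ≠ 0 := zpow_ne_zero _ hq
  rw [zpow_neg] at h
  rw [zpow_sub_one₀ hq]
  refine mul_left_cancel₀ hV ?_
  generalize (∫ t : kˣ, {s : k | s - 1 ∈ ball k i}.indicator
        (fun s => (Φ : k → ℂ) (x * s) - (Φ : k → ℂ) x) (t : k) ∂ν) = I at h ⊢
  generalize (residueCard k : ℂ) ^ i = w at h hi' ⊢
  have h3 := congrArg (fun z => w * z) h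
  field_simp at h3 ⊢
  linear_combination h3

lemma two_mul_integral_lLayer (hν : ν (integerUnits k) = 1) (Φ : Sch k) {x : k} (hx : x ≠ 0)
    (j : ℤ) : 2 * ∫ t, lLayer (Φ : k → ℂ) x j t ∂ν =
      (elemOp μ j Φ : k → ℂ) x - 2 * (ltInd j 0 - ltInd j (ordZ x)) * (Φ : k → ℂ) x := by
  -- the substitution `t ↦ x t` turns integrals of `Φ (x t)` into integrals of `Φ`
  have hsub (i : ℤ) : ∫ t : kˣ, (if ordZ (t : k) = i - ordZ x then (Φ : k → ℂ) (x * t) else 0) ∂ν =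
      sphereMean μ i Φ := by
    rw [← integral_sphere μ ν hν (continuous_Sch Φ) i,
      ← integral_mul_left_eq_self (fun t : kˣ => if ordZ (t : k) = i then (Φ : k → ℂ) t else 0)
        (Units.mk0 x hx)]
    congr 1
    ext t
    rw [Units.val_mul, Units.val_mk0, ordZ_mul hx t.ne_zero]
    simp only [eq_sub_iff_add_eq']
  unfold lLayer
  rcases lt_trichotomy j (ordZ x) with h | h | h
  · simp only [if_pos h]
    rw [hsub, elemOp_apply_of_mem μ Φ ((mem_ball_iff hx).2 h), ltInd_of_lt h]
    ring
  · simp only [h, lt_irrefl, if_false, if_true]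
    have h2 : (fun t : kˣ => if ordZ (t : k) = 0 then (Φ : k → ℂ) (x * t) - (Φ : k → ℂ) x else 0) =
        fun t : kˣ => (if ordZ (t : k) = ordZ x - ordZ x then (Φ : k → ℂ) (x * t) else 0)
          - (if ordZ (t : k) = 0 then (Φ : k → ℂ) x else 0) := by
      ext t
      rw [sub_self]
      split_ifs <;> simp
    rw [integral_const_mul, h2, integral_sub (integrable_sphere ν (continuous_mul_Sch Φ x) _)
      (integrable_sphere ν (f := fun _ => _) continuous_const 0), hsub,
      integral_sphere μ ν hν (f := fun _ => (Φ : k → ℂ) x) continuous_const,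
      sphereMean_of_invariantUnder μ (Φ := fun _ => (Φ : k → ℂ) x) (fun _ _ _ => rfl),
      elemOp_apply_of_sphere μ Φ (mem_ball_ordZ hx) (by rw [mem_ball_iff hx]; omega),
      ltInd_of_le le_rfl]
    ring
  · simp only [if_neg h.not_gt, if_neg h.ne']
    have h3 := integral_near_one μ ν hν Φ hx (i := j - ordZ x) (by omega)
    rw [add_sub_cancel] at h3
    rw [integral_const_mul, elemOp_apply_of_notMem μ Φ (by rw [mem_ball_iff hx]; omega),
      ltInd_of_le h.le]
    linear_combination h3

lemma sum_Icc_telescope (w : ℤ → ℂ) {a b : ℤ} (hab : a ≤ b) :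
    ∑ j ∈ Finset.Icc a b, (w j - w (j - 1)) = w b - w (a - 1) := by
  induction b, hab using Int.leInduction with
  | base => simp
  | succ b hb ih =>
    have h : Finset.Icc a (b + 1) = insert (b + 1) (Finset.Icc a b) := by
      ext j
      simp only [Finset.mem_insert, Finset.mem_Icc]
      omega
    rw [h, Finset.sum_insert (by simp), ih, add_sub_cancel_right]
    ring

lemma H_inv (t : kˣ) : H t⁻¹ = if ordZ (t : k) < 0 then 1 else
    if ordZ (t : k) = 0 then 1 / 2 else 0 := by
  have h1 : ((t⁻¹ : kˣ) : k) ∈ integers k ↔ ordZ (t : k) ≤ 0 := by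
    rw [integers_eq_ball, SetLike.mem_coe, mem_ball_iff (Units.ne_zero _),
      Units.val_inv_eq_inv_val, ordZ_inv]
    omega
  have h2 : t⁻¹ ∈ integerUnits k ↔ ordZ (t : k) = 0 := by
    rw [mem_integerUnits_iff, Units.val_inv_eq_inv_val, ordZ_inv, neg_eq_zero]
  classical
  rw [H, Set.indicator_apply, Set.indicator_apply]
  simp only [h1, h2, Pi.one_apply]
  split_ifs <;> first | omega | norm_num

lemma sum_lLayer {L : ℤ} {Φ : k → ℂ} {x : k} (hx : x ≠ 0) (hN : SupportedOn (-L) Φ)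
    (hM : InvariantUnder L Φ) (h1 : -L ≤ ordZ x) (h2 : ordZ x ≤ L) (t : kˣ) :
    ∑ j ∈ Finset.Icc (-L) L, lLayer Φ x j t = lPlusIntegrand μ Φ x t := by
  have hq : (residueCard k : ℂ) ≠ 0 := residueCard_cast_ne_zero (k := k)
  classical
  rw [lPlusIntegrand, H_inv, Set.indicator_apply, mem_integerUnits_iff]
  rcases lt_trichotomy (ordZ (t : k)) 0 with ht | ht | ht
  · -- for `‖t‖ > 1` one has `‖t - 1‖ = ‖t‖`
    have h3 := ordZ_eq_of_sub_mem (x := (t : k)) (y := (t : k) - 1) t.ne_zero (by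
      rw [sub_sub_cancel_left, neg_mem_iff, mem_ball_iff one_ne_zero, ordZ_one]
      omega)
    rw [if_pos ht, if_neg ht.ne, modulus_eq μ h3.1, modulus_eq μ t.ne_zero, h3.2]
    have hne : (((residueCard k : ℝ) ^ (-ordZ (t : k)) : ℝ) : ℂ) ≠ 0 := by
      push_cast
      exact zpow_ne_zero _ hq
    rw [div_mul_cancel₀ _ hne]
    have hl (j : ℤ) : lLayer Φ x j t = if ordZ x + ordZ (t : k) = j then Φ (x * t) else 0 := by
      rw [lLayer]
      have hn : ordZ x < j → (t : k) ∉ {s : k | s - 1 ∈ ball k (j - ordZ x)} := fun hj hs => by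
        have := (ordZ_eq_zero_of_sub_one_mem (by omega) hs).2
        omega
      rcases lt_trichotomy j (ordZ x) with h | h | h
      · rw [if_pos h]
        simp only [eq_sub_iff_add_eq']
      · rw [if_neg h.not_lt, if_pos h, if_neg ht.ne, if_neg (by omega), mul_zero]
      · rw [if_neg h.not_gt, if_neg h.ne', Set.indicator_of_notMem (hn h), mul_zero,
          if_neg (by omega)]
    simp_rw [hl]
    rw [Finset.sum_ite_eq]
    split_ifs with h
    · ring
    · rw [hN (x * t)]
      · ring
      · rw [mem_ball_iff (mul_ne_zero hx t.ne_zero), ordZ_mul hx t.ne_zero]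
        rw [Finset.mem_Icc] at h
        omega
  · rw [if_neg ht.not_lt, if_pos ht, if_pos ht, modulus_eq μ t.ne_zero, ht]
    by_cases hD : Φ (x * t) = Φ x
    · rw [hD, Finset.sum_eq_zero]
      · simp
      · intro j _
        have h3 : Set.indicator {s : k | s - 1 ∈ ball k (j - ordZ x)}
            (fun s => Φ (x * s) - Φ x) (t : k) = 0 := by
          rw [Set.indicator_apply, hD, sub_self, ite_self]
        rw [lLayer, h3, hD, ht]
        split_ifs with h4 h5 <;> first | omega | simp
    · have ht1 : (t : k) - 1 ≠ 0 := fun h => hD (by rw [sub_eq_zero.1 h, mul_one])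
      set r := ordZ ((t : k) - 1) with hr
      have hr0 : 0 ≤ r := by
        rw [hr, ← mem_ball_iff ht1]
        exact sub_mem ((mem_ball_iff t.ne_zero).2 ht.ge)
          ((mem_ball_iff one_ne_zero).2 ordZ_one.ge)
      have hrL : ordZ x + r < L := by
        by_contra hcon
        refine hD (hM.eq_of_sub_mem ?_)
        have : x * t - x = x * (t - 1) := by ring
        rw [this, mem_ball_iff (mul_ne_zero hx ht1), ordZ_mul hx ht1]
        omega
      -- the coefficients telescope to `‖t - 1‖⁻¹`
      let w : ℤ → ℂ := fun j =>
        if j < ordZ x then 0 else (residueCard k : ℂ) ^ (min (j - ordZ x) r)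
      have hl (j : ℤ) : lLayer Φ x j t = (w j - w (j - 1)) * ((1 / 2) * (Φ (x * t) - Φ x)) := by
        simp only [lLayer, w]
        rcases lt_trichotomy j (ordZ x) with h | h | h
        · rw [if_pos h, if_neg (by omega), if_pos h, if_pos (by omega)]
          ring
        · rw [if_neg h.not_lt, if_pos h, if_pos ht, if_neg h.not_lt, if_pos (by omega), h,
            sub_self, min_eq_left hr0, zpow_zero]
          ring
        · rw [if_neg h.not_gt, if_neg h.ne', if_neg h.not_gt, if_neg (by omega),
            Set.indicator_apply]
          simp only [Set.mem_ofPred_eq, mem_ball_iff ht1, ← hr]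
          split_ifs with h4
          · rw [min_eq_left h4, min_eq_left (by omega), sub_right_comm]
            ring
          · rw [min_eq_right (by omega), min_eq_right (by omega)]
            ring
      simp_rw [hl]
      rw [← Finset.sum_mul, sum_Icc_telescope w (h1.trans h2), modulus_eq μ ht1, ← hr]
      simp only [w]
      rw [if_neg (by omega), if_pos (by omega), min_eq_right (by omega)]
      simp only [neg_zero, zpow_zero, Pi.one_apply]
      push_cast
      rw [zpow_neg]
      have := zpow_ne_zero r hq
      field_simp
      ring
  · rw [if_neg ht.not_gt, if_neg ht.ne', if_neg ht.ne', Finset.sum_eq_zero]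
    · simp
    · intro j _
      rw [lLayer, if_neg ht.ne']
      split_ifs with h3 h4 h5
      · omega
      · rfl
      · rw [mul_zero]
      · rw [Set.indicator_of_notMem, mul_zero]
        intro hs
        have := (ordZ_eq_zero_of_sub_one_mem (by omega) hs).2
        omega

lemma exists_bound_at (Φ : Sch k) (x : k) : ∃ L : ℤ, 0 ≤ L ∧ SupportedOn (-L) (Φ : k → ℂ) ∧
    InvariantUnder L (Φ : k → ℂ) ∧ -L ≤ ordZ x ∧ ordZ x ≤ L := by
  obtain ⟨L, hL, h⟩ := exists_bound Φ
  obtain ⟨hN, hM⟩ := h (max L |ordZ x|) (le_max_left _ _)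
  have h1 := neg_abs_le (ordZ x)
  have h2 := le_abs_self (ordZ x)
  exact ⟨max L |ordZ x|, by omega, hN, hM, by omega, by omega⟩

lemma integrable_lPlusIntegrand (Φ : Sch k) {x : k} (hx : x ≠ 0) :
    Integrable (lPlusIntegrand μ (Φ : k → ℂ) x) ν := by
  obtain ⟨L, _, hN, hM, h1, h2⟩ := exists_bound_at Φ x
  rw [← funext (sum_lLayer μ hx hN hM h1 h2)]
  exact integrable_finsetSum _ fun j _ => integrable_lLayer ν Φ x j

lemma finsum_elemOp_of_ne_zero (hν : ν (integerUnits k) = 1) (Φ : Sch k) {x : k} (hx : x ≠ 0) :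
    ((∑ᶠ j, elemOp μ j Φ : Sch k) : k → ℂ) x =
      2 * LPlus μ ν Φ x - 2 * ordZ x * (Φ : k → ℂ) x := by
  obtain ⟨L, hL, hN, hM, h1, h2⟩ := exists_bound_at Φ x
  have hs : ∑ j ∈ Finset.Icc (-L) L, (ltInd j 0 - ltInd j (ordZ x)) = -(ordZ x : ℂ) := by
    rw [← finsum_ltInd_sub, finsum_eq_sum_of_support_subset]
    refine (support_ltInd_sub _).trans fun j hj => ?_
    rw [Finset.coe_Ico, Set.mem_Ico] at hj
    rw [Finset.coe_Icc, Set.mem_Icc]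
    omega
  rw [finsum_elemOp_apply μ hL hN hM, LPlus, ← funext (sum_lLayer μ hx hN hM h1 h2),
    integral_finsetSum _ fun j _ => integrable_lLayer ν Φ x j, Finset.mul_sum]
  simp_rw [two_mul_integral_lLayer μ ν hν Φ hx]
  rw [Finset.sum_sub_distrib, ← Finset.sum_mul, ← Finset.mul_sum, hs]
  ring

lemma isStirlingOperator_stirlingOp (κ : kˣ) (hν : ν (integerUnits k) = 1) :
    IsStirlingOperator κ μ ν (stirlingOp μ (ordZ (κ : k))) := by
  have hval (Φ : Sch k) (x : k) : (stirlingOp μ (ordZ (κ : k)) Φ : k → ℂ) x =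
      -(ordZ (κ : k) : ℂ) / 2 * (Φ : k → ℂ) x
        + 1 / 2 * ((∑ᶠ j, elemOp μ j Φ : Sch k) : k → ℂ) x := rfl
  refine fun Φ => ⟨fun x hx => ?_, ?_⟩
  · rw [hval, finsum_elemOp_of_ne_zero μ ν hν Φ hx, ord_eq μ κ.ne_zero, ord_eq μ hx]
    push_cast
    ring
  · rw [hval, finsum_elemOp_zero μ ν hν Φ, ord_eq μ κ.ne_zero]
    push_cast
    ring

lemma IsStirlingOperator.unique {κ : kˣ} {K K' : Sch k →ₗ[ℂ] Sch k}
    (hK : IsStirlingOperator κ μ ν K) (hK' : IsStirlingOperator κ μ ν K') : K' = K := by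
  refine LinearMap.ext fun Φ => Subtype.ext (funext fun x => ?_)
  rcases eq_or_ne x 0 with rfl | hx
  · rw [(hK Φ).2, (hK' Φ).2]
  · rw [(hK Φ).1 x hx, (hK' Φ).1 x hx]

end Formula

end LocalStirling

end

theorem mainTheorem5
    {k : Type*} [Field k] [ValuativeRel k] [TopologicalSpace k] [IsNonarchimedeanLocalField k]
    [MeasurableSpace k] [BorelSpace k]
    -- a nonconstant continuous additive character of `k`
    (e : AddChar k Circle) (he : Continuous e) (hne : ∃ x : k, e x ≠ 1)
    -- `κ⁻¹ 𝒪 = {ξ | ξ 𝒪 ⊆ ker e}`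
    (κ : kˣ)
    (hκ : LocalStirling.dilate ((κ⁻¹ : kˣ) : k) =
      {ξ : k | ∀ y ∈ LocalStirling.integers k, e (ξ * y) = 1})
    -- Haar measure on `k`, normalized by `μ(𝒪) μ(κ⁻¹ 𝒪) = 1`
    (μ : Measure k) [μ.IsAddHaarMeasure]
    (hμ : μ (LocalStirling.integers k) * μ (LocalStirling.dilate ((κ⁻¹ : kˣ) : k)) = 1)
    -- Haar measure on `kˣ`, normalized by `ν(𝒪ˣ) = 1`
    (ν : Measure kˣ) [ν.IsHaarMeasure]
    (hν : ν (LocalStirling.integerUnits k) = 1) :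
    -- the integrals defining `M^{(1)}[Φ]` and `L⁺[Φ](x)` converge absolutely
    (∀ Φ : LocalStirling.Sch k,
      Integrable (LocalStirling.mIntegrand 1 (Φ : k → ℂ)) ν ∧
      ∀ x : k, x ≠ 0 → Integrable (LocalStirling.lPlusIntegrand μ (Φ : k → ℂ) x) ν) ∧
    -- the Fourier transform preserves the Schwartz space
    ∃ hF : ∀ Φ : LocalStirling.Sch k,
        Fourier.fourierIntegral e μ (Φ : k → ℂ) ∈ LocalStirling.Sch k,
      ∃ K : LocalStirling.Sch k →ₗ[ℂ] LocalStirling.Sch k,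
        LocalStirling.IsStirlingOperator κ μ ν K ∧
        (∀ K' : LocalStirling.Sch k →ₗ[ℂ] LocalStirling.Sch k,
          LocalStirling.IsStirlingOperator κ μ ν K' → K' = K) ∧
        ∀ Φ : LocalStirling.Sch k,
          (K ⟨Fourier.fourierIntegral e μ (Φ : k → ℂ), hF Φ⟩ : k → ℂ) =
            -Fourier.fourierIntegral e μ (K Φ : k → ℂ) := by
  have ho : LocalStirling.HasConductor e (LocalStirling.ordZ (κ : k)) := fun ξ => by
    rw [LocalStirling.dilate_eq_ball κ⁻¹.ne_zero, Units.val_inv_eq_inv_val,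
      LocalStirling.ordZ_inv, LocalStirling.integers_eq_ball] at hκ
    exact Set.ext_iff.1 hκ ξ
  refine ⟨fun Φ => ⟨LocalStirling.integrable_mIntegrand ν Φ, fun x hx =>
    LocalStirling.integrable_lPlusIntegrand μ ν Φ hx⟩, LocalStirling.fourier_mem_Sch μ ho,
    LocalStirling.stirlingOp μ (LocalStirling.ordZ (κ : k)),
    LocalStirling.isStirlingOperator_stirlingOp μ ν κ hν, fun K' hK' =>
      (LocalStirling.isStirlingOperator_stirlingOp μ ν κ hν).unique μ ν hK', fun Φ => ?_⟩
  exact congrArg Subtype.val (LocalStirling.stirlingOp_fourierOp μ he ho Φ)
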